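/- **Setting.** Let $(X_n)_{n\ge 0}$ be a Markov chain on a measurable space $\mathcal X$ with countably generated $\sigma$-algebra, with transition kernel $P$, invariant probability measure $\mu$ and arbitrary initial distribution; let $\mathcal F_n=\sigma(X_0,\dots,X_n)$. For $V:\mathcal X\to[1,\infty)$ put $|f|_V=\sup_x|f(x)|/V(x)$ and $\|\nu\|_V=\int V\,d|\nu|$ for a finite signed measure $\nu$, and let $\mathcal L_V$ be the set of measurable $f$ with $|f|_V<\infty$. For $V\le W$, condition $\mathcal C(1,V,W)$ says that for some finite constant $C$, $\sum_{\ell\ge 0}\|P^\ell(x,\cdot)-\mu\|_V\le C\,W(x)$ for all $x$. **(A2)** $V_1,V_2,V_3:\mathcal X\to[1,\infty)$ are measurable, $V_1\le V_2$, $V_2^2\le V_3$, $PV_3(x)<\infty$ for all $x$, $P$ satisfies $\mathcal C(1,V_1,V_2)$ and $\mathcal C(1,V_2^2,V_3)$, and $\sup_{n\ge0}\mathbb E[V_3(X_n)^q]<\infty$ for some $q>1$. **(W)** $b>0$ and $w_b:[0,\infty)\to[0,1]$ is continuous, vanishes outside $[0,b]$, satisfies $w_b(0)=1$ and $w_b(b)=0$,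 and is of class $\mathcal C^2$ on $(0,b)$ with bounded second derivative there. Let $(c_n)_{n\ge1}$ be a nondecreasing sequence of positive numbers with $c_n=O(n)$. For $h\in\mathcal L_{V_1}$ with $\mu(h)=0$ let $\mu_n(h)=n^{-1}\sum_{j=1}^nh(X_j)$, $\gamma_{n,k}=n^{-1}\sum_{j=1}^{n-k}(h(X_j)-\mu_n(h))(h(X_{j+k})-\mu_n(h))$, and let $$\Gamma_{n,b}^2(h)=\gamma_{n,0}+2\sum_{k=1}^{n-1}w_b(k/c_n)\gamma_{n,k}$$ be the lag-window estimator. Put $w_{n,b}(k)=0$ for $k<0$, $w_{n,b}(0)=1/n$, $w_{n,b}(k)=\frac2n w_b(k/c_n)$ for $k>0$; $G=\sum_{j\ge0}P^jh$; $Q_\ell=G(X_\ell)-PG(X_{\ell-1})$; $S_n=\sum_{j=1}^nh(X_j)$; $$R_n=\frac{2S_n^2}{n^2}\sum_{k=1}^{n-1}w_b\Big(\frac k{c_n}\Big)\Big(1-\frac kn\Big)-\frac{2S_n}{n^2}\Big(\sum_{j=2}^nh(X_j)\sum_{k=1}^{j-1}w_b\Big(\frac k{c_n}\Big)+\sum_{j=1}^{n-1}h(X_j)\sum_{k=1}^{n-j}w_b\Big(\frac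 k{c_n}\Big)\Big)-\frac{S_n^2}{n^2};$$ and, writing $G_\ell=G(X_\ell)$, $g_\ell=PG(X_\ell)$, $a=w_{n,b}$, $$\begin{aligned}\zeta_n={}&\sum_{\ell=1}^n\sum_{j=1}^\ell\Big\{[a(\ell-j)-a(\ell-1-j)]\,g_{\ell-1}(G_j-g_{j-1})+[a(\ell-j)-a(\ell-j+1)]\,g_{j-1}(G_\ell-g_{\ell-1})\\&\qquad+[2a(\ell-j)-a(\ell-j+1)-a(\ell-j-1)]\,g_{\ell-1}g_{j-1}\Big\}\\&+\sum_{\ell=1}^n\big\{a(\ell)g_0G_\ell-a(\ell-1)g_0g_{\ell-1}\big\}+\sum_{j=1}^na(n-j)\,g_n(g_j-G_j)+\sum_{\ell=1}^n\big\{a(-1)g_{\ell-1}G_\ell-a(0)g_\ell G_\ell\big\}.\end{aligned}$$ **Theorem.** Assume (A2) and (W). For every $h\in\mathcal L_{V_1}$ with $\mu(h)=0$, the functions $G$ and $PG$ are well defined everywhere (absolutely convergent series and integral), and for all $n\ge1$ $$\Gamma_{n,b}^2(h)=\frac1n\sum_{\ell=1}^nQ_\ell^2+\sum_{\ell=1}^n\sum_{j=1}^{\ell-1}w_{n,b}(\ell-j)Q_\ell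 Q_j+R_n+\zeta_n ,$$ where, for fixed $n$, $m\mapsto\sum_{\ell=1}^m\sum_{j=1}^{\ell-1}w_{n,b}(\ell-j)Q_\ell Q_j$ is a martingale with respect to $(\mathcal F_m)$. Furthermore there exist $p>1$ and a finite constant $C$, not depending on $h$ or $n$, such that for all $n\ge3$ and all $h\in\mathcal L_{V_1}$ with $\mu(h)=0$, $$\mathbb E^{1/p}(|\zeta_n|^p)\le C|h|_{V_1}^2\,c_n^{-1+\frac12\vee\frac1p},\qquad \mathbb E^{1/p}(|R_n|^p)\le C|h|_{V_1}^2\,\frac{c_n}n,$$ $$\mathbb E^{1/p}\Big(\Big|\sum_{\ell=1}^n\sum_{j=1}^{\ell-1}w_{n,b}(\ell-j)Q_\ell Q_j\Big|^p\Big)\le C|h|_{V_1}^2\Big(\frac{c_n}n\Big)^{1/2}n^{-\frac12+\frac1p\vee\frac12}.$$ -/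

import Mathlib

open MeasureTheory ProbabilityTheory

open scoped ENNReal NNReal

noncomputable section

namespace LagWindow

/-! ### Weighted norms and short-range dependence -/

section Norms

variable {S : Type*} [MeasurableSpace S]

/-- The weighted norm `‖ν‖_V = ∫ V d|ν|` of a signed measure. -/
def wNorm (V : S → ℝ) (ν : SignedMeasure S) : ℝ≥0∞ :=
  ∫⁻ x, ENNReal.ofReal (V x) ∂ν.totalVariation

/-- The weighted norm `|f|_V = sup_x |f x| / V x` of a function. -/
def wFunNorm (V : S → ℝ) (f : S → ℝ) : ℝ≥0∞ :=
  ⨆ x, ENNReal.ofReal (|f x| / V x)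

/-- Membership in the space of measurable functions of finite `V`-norm. -/
def MemLW (V : S → ℝ) (f : S → ℝ) : Prop :=
  Measurable f ∧ wFunNorm V f < ∞

/-- Iterates of a Markov kernel are Markov kernels. -/
instance isMarkovKernel_pow (P : Kernel S S) [IsMarkovKernel P] (n : ℕ) :
    IsMarkovKernel (P ^ n) := by
  induction n with
  | zero =>
    rw [pow_zero]
    change IsMarkovKernel (Kernel.id : Kernel S S)
    infer_instance
  | succ k ih =>
    rw [pow_succ]
    change IsMarkovKernel ((P ^ k) ∘ₖ P)
    infer_instance

/-- The univariate short-range dependence condition: for some finite constant `C`,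
`∑_{ℓ ≥ 0} ‖P^ℓ(x,·) - μ‖_V ≤ C W(x)` for all `x`. -/
def ShortRange (P : Kernel S S) [IsMarkovKernel P] (μ : Measure S) [IsProbabilityMeasure μ]
    (V W : S → ℝ) : Prop :=
  ∃ C : ℝ≥0, ∀ x,
    ∑' ℓ : ℕ, wNorm V (((P ^ ℓ) x).toSignedMeasure - μ.toSignedMeasure)
      ≤ (C : ℝ≥0∞) * ENNReal.ofReal (W x)

end Norms

/-! ### Markov chains -/

section Chain

variable {S Ω : Type*} [MeasurableSpace S] [MeasurableSpace Ω]

/-- The filtration `F_n = σ(X_0, …, X_n)`. -/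
def history (X : ℕ → Ω → S) (hX : ∀ n, Measurable (X n)) :
    Filtration ℕ (inferInstance : MeasurableSpace Ω) where
  seq n := ⨆ i ≤ n, MeasurableSpace.comap (X i) inferInstance
  mono' _ _ hij := biSup_mono fun _ hk => hk.trans hij
  le' _ := iSup₂_le fun i _ => (hX i).comap_le

/-- `X` is a Markov chain with transition kernel `P` (and arbitrary initial distribution):
`Prob(X_{n+1} ∈ A | X_0, …, X_n) = P(X_n, A)` almost surely. -/
structure IsMarkovChain (P : Kernel S S) (Pr : Measure Ω) (X : ℕ → Ω → S) : Prop where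
  measurable : ∀ n, Measurable (X n)
  markov : ∀ n : ℕ, ∀ A : Set S, MeasurableSet A →
    Pr[(X (n + 1) ⁻¹' A).indicator (fun _ => (1 : ℝ)) | history X measurable n]
      =ᵐ[Pr] fun ω => (P (X n ω)).real A

/-- The ergodicity and moment assumption on the chain. -/
structure Ergodicity (P : Kernel S S) [IsMarkovKernel P] (μ : Measure S)
    [IsProbabilityMeasure μ] (Pr : Measure Ω) (X : ℕ → Ω → S) (V₁ V₂ V₃ : S → ℝ) : Prop where
  measurable₁ : Measurable V₁
  measurable₂ : Measurable V₂
  measurable₃ : Measurable V₃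
  one_le : ∀ x, 1 ≤ V₁ x
  le₁₂ : ∀ x, V₁ x ≤ V₂ x
  le₂₃ : ∀ x, V₂ x ^ 2 ≤ V₃ x
  finite : ∀ x, ∫⁻ z, ENNReal.ofReal (V₃ z) ∂(P x) < ∞
  shortRange₁₂ : ShortRange P μ V₁ V₂
  shortRange₂₃ : ShortRange P μ (fun x => V₂ x ^ 2) V₃
  moment : ∃ q : ℝ, 1 < q ∧ ⨆ n : ℕ, ∫⁻ ω, ENNReal.ofReal (V₃ (X n ω) ^ q) ∂Pr < ∞

/-- `G = ∑_{j ≥ 0} P^j h`. -/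
def poissonSol (P : Kernel S S) (h : S → ℝ) (x : S) : ℝ :=
  ∑' j : ℕ, ∫ z, h z ∂((P ^ j) x)

/-- `PG`. -/
def poissonSolNext (P : Kernel S S) (h : S → ℝ) (x : S) : ℝ :=
  ∫ z, poissonSol P h z ∂(P x)

/-- `Q_ℓ = G(X_ℓ) - PG(X_{ℓ-1})`, used for `ℓ ≥ 1`. -/
def incr (P : Kernel S S) (h : S → ℝ) (X : ℕ → Ω → S) (ℓ : ℕ) (ω : Ω) : ℝ :=
  poissonSol P h (X ℓ ω) - poissonSolNext P h (X (ℓ - 1) ω)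

end Chain

/-! ### Lag windows -/

/-- The assumption on the lag window `w : [0,∞) → [0,1]`; only its values on `[0,∞)` matter. -/
structure Window (b : ℝ) (w : ℝ → ℝ) : Prop where
  pos : 0 < b
  cont : ContinuousOn w (Set.Ici 0)
  mem : ∀ x, 0 ≤ x → w x ∈ Set.Icc (0 : ℝ) 1
  supp : ∀ x, b < x → w x = 0
  zero : w 0 = 1
  right : w b = 0
  smooth : ContDiffOn ℝ 2 w (Set.Ioo 0 b)
  bounded : ∃ M : ℝ, ∀ x ∈ Set.Ioo 0 b, |deriv (deriv w) x| ≤ M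

/-- The bandwidths: a nondecreasing sequence of positive numbers (indexed by `n ≥ 1`)
with `c_n = O(n)`. -/
structure Bandwidth (c : ℕ → ℝ) : Prop where
  pos : ∀ n, 1 ≤ n → 0 < c n
  mono : MonotoneOn c (Set.Ici 1)
  le : ∃ K : ℝ, ∀ n : ℕ, 1 ≤ n → c n ≤ K * n

/-- Sample mean of `y_1, …, y_n`. -/
def sampleMean (n : ℕ) (y : ℕ → ℝ) : ℝ := (n : ℝ)⁻¹ * ∑ j ∈ Finset.Icc 1 n, y j

/-- `k`-th order sample autocovariance of `y_1, …, y_n`, for `k ≤ n`. -/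
def sampleAutocov (n k : ℕ) (y : ℕ → ℝ) : ℝ :=
  (n : ℝ)⁻¹ * ∑ j ∈ Finset.Icc 1 (n - k),
    (y j - sampleMean n y) * (y (j + k) - sampleMean n y)

/-- The lag-window estimator built from `y_1, …, y_n` with bandwidth `c`. -/
def estimator (w : ℝ → ℝ) (c : ℝ) (n : ℕ) (y : ℕ → ℝ) : ℝ :=
  sampleAutocov n 0 y + 2 * ∑ k ∈ Finset.Icc 1 (n - 1), w (k / c) * sampleAutocov n k y

/-- The weights: `1/n` at lag `0`, `(2/n) w(k/c)` at lags `k > 0`, and `0` at negative lags. -/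
def weight (w : ℝ → ℝ) (c : ℝ) (n : ℕ) (k : ℤ) : ℝ :=
  if k < 0 then 0 else if k = 0 then (n : ℝ)⁻¹ else 2 * (n : ℝ)⁻¹ * w (k / c)

/-- The remainder `R_n` caused by centring at the sample mean. -/
def remR (w : ℝ → ℝ) (c : ℝ) (n : ℕ) (y : ℕ → ℝ) : ℝ :=
  2 * ((n : ℝ) ^ 2)⁻¹ * (∑ j ∈ Finset.Icc 1 n, y j) ^ 2
      * ∑ k ∈ Finset.Icc 1 (n - 1), w (k / c) * (1 - (k : ℝ) / n)
    - 2 * ((n : ℝ) ^ 2)⁻¹ * (∑ j ∈ Finset.Icc 1 n, y j)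
      * ((∑ j ∈ Finset.Icc 2 n, y j * ∑ k ∈ Finset.Icc 1 (j - 1), w (k / c))
        + ∑ j ∈ Finset.Icc 1 (n - 1), y j * ∑ k ∈ Finset.Icc 1 (n - j), w (k / c))
    - ((n : ℝ) ^ 2)⁻¹ * (∑ j ∈ Finset.Icc 1 n, y j) ^ 2

/-- The remainder `ζ_n` of the martingale approximation, for weights `a (ℓ - j)`, in terms of
`G ℓ = G(X_ℓ)` and `g ℓ = PG(X_ℓ)`. -/
def remZeta (a : ℤ → ℝ) (n : ℕ) (G g : ℕ → ℝ) : ℝ :=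
  (∑ ℓ ∈ Finset.Icc 1 n, ∑ j ∈ Finset.Icc 1 ℓ,
      (a (ℓ - j) - a (ℓ - 1 - j)) * (g (ℓ - 1) * G j - g (ℓ - 1) * g (j - 1)))
    + (∑ ℓ ∈ Finset.Icc 1 n, ∑ j ∈ Finset.Icc 1 ℓ,
      (a (ℓ - j) - a (ℓ - (j - 1))) * (g (j - 1) * G ℓ - g (ℓ - 1) * g (j - 1)))
    + (∑ ℓ ∈ Finset.Icc 1 n, ∑ j ∈ Finset.Icc 1 ℓ,
      (2 * a (ℓ - j) - a (ℓ - (j - 1)) - a (ℓ - 1 - j)) * (g (ℓ - 1) * g (j - 1)))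
    + (∑ ℓ ∈ Finset.Icc 1 n, (a ℓ * (g 0 * G ℓ) - a (ℓ - 1) * (g 0 * g (ℓ - 1))))
    + (∑ j ∈ Finset.Icc 1 n, a (n - j) * (g n * g j - g n * G j))
    + ∑ ℓ ∈ Finset.Icc 1 n, (a (-1) * (g (ℓ - 1) * G ℓ) - a 0 * (g ℓ * G ℓ))

section Terms

variable {S Ω : Type*} [MeasurableSpace S]

/-- The quadratic form `∑_{ℓ=1}^m ∑_{j=1}^{ℓ-1} a(ℓ - j) Q_ℓ Q_j`. -/
def quadMart (a : ℤ → ℝ) (P : Kernel S S) (h : S → ℝ) (X : ℕ → Ω → S) (m : ℕ) (ω : Ω) : ℝ :=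
  ∑ ℓ ∈ Finset.Icc 1 m, ∑ j ∈ Finset.Icc 1 (ℓ - 1),
    a (ℓ - j) * incr P h X ℓ ω * incr P h X j ω

/-- The lag-window estimator along the chain. -/
def gammaSq (w : ℝ → ℝ) (c : ℕ → ℝ) (h : S → ℝ) (X : ℕ → Ω → S) (n : ℕ) (ω : Ω) : ℝ :=
  estimator w (c n) n fun j => h (X j ω)

/-- `R_n` along the chain. -/
def chainR (w : ℝ → ℝ) (c : ℕ → ℝ) (h : S → ℝ) (X : ℕ → Ω → S) (n : ℕ) (ω : Ω) : ℝ :=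
  remR w (c n) n fun j => h (X j ω)

/-- `ζ_n` along the chain. -/
def chainZeta (w : ℝ → ℝ) (c : ℕ → ℝ) (P : Kernel S S) (h : S → ℝ) (X : ℕ → Ω → S)
    (n : ℕ) (ω : Ω) : ℝ :=
  remZeta (weight w (c n) n) n (fun j => poissonSol P h (X j ω))
    fun j => poissonSolNext P h (X j ω)

end Terms

end LagWindow

end

/-! The Poisson equation `h = G - PG` turns the observations into `h(X_j) = G_j - g_j`, while `Q_ℓ =
G_ℓ - g_{ℓ-1}` is a martingale difference by the Markov property. Since `μ(h) = 0`, each `|P^j h|`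
is dominated by the weighted distance from `P^j(x,·)` to `μ`, so short-range dependence gives
convergence and the bounds `|G|, |PG| ≤ C |h| V₂` (`Ergodicity.exists_poisson`).

The decomposition itself is algebra, pointwise in `ω`. The estimator is a lower-triangular quadratic
form in the observations up to the centring term (`estimator_eq`), and summation by parts replaces
each factor `G_j - g_j` by `G_j - g_{j-1}` at the cost of `remZeta` (`sum_quadratic_eq`). The
diagonal of the new form is the average of the `Q_ℓ²`; the rest is a martingale.

For the bounds, `V₂² ≤ V₃` and the moment assumption place `G_j` and `g_j` in `L^{2p}` uniformly in
`j`, with `1 < p ≤ 3/2`. Two martingale inequalities suffice: von Bahr–Esseen in `L^p` for the outer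
sums, whose terms are products of two `L^{2p}` factors, and a square-root bound in `L^{2p}` for the
inner linear sums. Both follow by induction on time from a Taylor inequality for `|x + y|^r` whose
linear term has zero mean. The restriction `2p ≤ 3` keeps the Taylor remainder elementary.

The term `ζ_n` is small only after a cancellation (`remZeta_eq`): the weight doubles between lags
`0` and `1` in the limit of large bandwidth, so some differences of weights are of order `1/n`
however smooth the window is. Their contributions combine into a martingale sum and a telescoping
sum. What remains involves first differences with sum of squares `O(1/(n² c))`, second differences
with absolute sum `O(1/(n c))`, sums with predictable coefficients, and boundary terms
(`Window.exists_weightBounds`, `lpBound_remZeta`). The term `R_n` needs only that partial sums of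
`h(X_j)` have `L^{2p}` norm `O(√n)` and that the window values sum to `O(c)`. -/

noncomputable section

namespace LagWindow

/-! ### Signed powers -/

/-- The signed power `sgn(x) |x|^s`, up to its factor the derivative of `|x|^(s+1)`. -/
def signedPow (s x : ℝ) : ℝ := |x| ^ (s - 1) * x

theorem signedPow_of_nonneg {s x : ℝ} (hs : 0 < s) (hx : 0 ≤ x) : signedPow s x = x ^ s := by
  unfold signedPow
  rcases hx.eq_or_lt with rfl | hx
  · simp [Real.zero_rpow hs.ne']
  · rw [abs_of_pos hx, Real.rpow_sub_one hx.ne']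
    field_simp

theorem signedPow_neg (s x : ℝ) : signedPow s (-x) = -signedPow s x := by
  simp [signedPow]

theorem abs_signedPow {s : ℝ} (hs : 0 < s) (x : ℝ) : |signedPow s x| = |x| ^ s := by
  rw [← signedPow_of_nonneg hs (abs_nonneg x)]
  simp [signedPow, abs_mul, abs_of_nonneg (Real.rpow_nonneg (abs_nonneg x) _)]

theorem measurable_signedPow (s : ℝ) : Measurable (signedPow s) := by
  unfold signedPow
  fun_prop

/-- A symmetry reduction for bounds on differences of signed powers. -/
theorem signedPow_sub_induction {s : ℝ} {B : ℝ → ℝ → ℝ}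
    (hsymm : ∀ u v, B u v = B v u) (hneg : ∀ u v, B (-u) (-v) = B u v)
    (hpos : ∀ u v, 0 ≤ v → v ≤ u → |signedPow s u - signedPow s v| ≤ B u v)
    (hopp : ∀ u v, v ≤ 0 → 0 ≤ u → |signedPow s u - signedPow s v| ≤ B u v) (u v : ℝ) :
    |signedPow s u - signedPow s v| ≤ B u v := by
  have key : ∀ u v, v ≤ u → |signedPow s u - signedPow s v| ≤ B u v := by
    intro u v huv
    rcases le_total 0 v with hv | hv
    · exact hpos u v hv huv
    · rcases le_total 0 u with hu | hu
      · exact hopp u v hv hu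
      · have := hpos (-v) (-u) (by linarith) (by linarith)
        rw [signedPow_neg, signedPow_neg, hneg, hsymm] at this
        rwa [show -signedPow s v - -signedPow s u = signedPow s u - signedPow s v by ring] at this
  rcases le_total v u with huv | huv
  · exact key u v huv
  · rw [abs_sub_comm, hsymm]
    exact key v u huv

/-- For equal signs this is subadditivity of `t ^ s`; for opposite signs both `|u|` and `|v|` are at
most `|u - v|`, which costs the factor `2`. -/
theorem abs_signedPow_sub_le_of_le_one {s : ℝ} (hs : 0 < s) (hs1 : s ≤ 1) (u v : ℝ) :
    |signedPow s u - signedPow s v| ≤ 2 * |u - v| ^ s := by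
  refine signedPow_sub_induction (B := fun u v => 2 * |u - v| ^ s) ?_ ?_ ?_ ?_ u v
  · intro u v
    simp only [abs_sub_comm]
  · intro u v
    simp only [neg_sub_neg, abs_sub_comm]
  · intro u v hv huv
    have hu := hv.trans huv
    simp only [signedPow_of_nonneg hs hu, signedPow_of_nonneg hs hv]
    have h1 := Real.rpow_le_rpow hv huv hs.le
    have h2 := Real.rpow_add_le_add_rpow (sub_nonneg.2 huv) hv hs.le hs1
    rw [sub_add_cancel] at h2
    rw [abs_of_nonneg (sub_nonneg.2 h1), abs_of_nonneg (sub_nonneg.2 huv)]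
    have := Real.rpow_nonneg (sub_nonneg.2 huv) s
    linarith
  · intro u v hv hu
    have h0 : |u - v| = u - v := abs_of_nonneg (by linarith)
    have h1 : |u| ^ s ≤ (u - v) ^ s :=
      Real.rpow_le_rpow (abs_nonneg _) (by rw [abs_of_nonneg hu]; linarith) hs.le
    have h2 : |v| ^ s ≤ (u - v) ^ s :=
      Real.rpow_le_rpow (abs_nonneg _) (by rw [abs_of_nonpos hv]; linarith) hs.le
    have h3 := abs_sub (signedPow s u) (signedPow s v)
    rw [abs_signedPow hs, abs_signedPow hs] at h3
    simp only [h0]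
    linarith

/-- For equal signs, Bernoulli's inequality at `v / u`, multiplied by `u ^ s`; for opposite signs
`|u - v| = |u| + |v|` and each term is bounded separately. -/
theorem abs_signedPow_sub_le_of_one_le {s : ℝ} (hs : 1 ≤ s) (u v : ℝ) :
    |signedPow s u - signedPow s v| ≤ s * (max |u| |v| ^ (s - 1) * |u - v|) := by
  have hs0 : 0 < s := by linarith
  refine signedPow_sub_induction (B := fun u v => s * (max |u| |v| ^ (s - 1) * |u - v|))
    ?_ ?_ ?_ ?_ u v
  · intro u v
    simp only [abs_sub_comm, max_comm]
  · intro u v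
    simp only [neg_sub_neg, abs_sub_comm, abs_neg]
  · intro u v hv huv
    have hu := hv.trans huv
    simp only [signedPow_of_nonneg hs0 hu, signedPow_of_nonneg hs0 hv, abs_of_nonneg hu,
      abs_of_nonneg hv, max_eq_left huv]
    have h1 := Real.rpow_le_rpow hv huv hs0.le
    rw [abs_of_nonneg (sub_nonneg.2 h1), abs_of_nonneg (sub_nonneg.2 huv)]
    rcases hu.eq_or_lt with rfl | hu
    · obtain rfl : v = 0 := le_antisymm huv hv
      simp
    · have h2 := one_add_mul_self_le_rpow_one_add (s := v / u - 1)
        (by have := div_nonneg hv hu.le; linarith) hs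
      rw [show 1 + (v / u - 1) = v / u by ring, Real.div_rpow hv hu.le,
        le_div_iff₀ (Real.rpow_pos_of_pos hu s)] at h2
      have h3 : u ^ s = u ^ (s - 1) * u := by rw [Real.rpow_sub_one hu.ne']; field_simp
      have h4 : u ^ s * (v / u) = u ^ (s - 1) * v := by rw [h3]; field_simp
      have h5 : (1 + s * (v / u - 1)) * u ^ s
          = u ^ s + s * (u ^ s * (v / u) - u ^ s) := by ring
      rw [h5, h4] at h2
      nlinarith [h2, h3]
  · intro u v hv hu
    have h0 : |u - v| = |u| + |v| := by
      rw [abs_of_nonneg hu, abs_of_nonpos hv, abs_of_nonneg] <;> linarith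
    have h3 := abs_sub (signedPow s u) (signedPow s v)
    have hb : ∀ w : ℝ, |w| ≤ max |u| |v| →
        |signedPow s w| ≤ max |u| |v| ^ (s - 1) * |w| := by
      intro w hw
      unfold signedPow
      rw [abs_mul, abs_of_nonneg (Real.rpow_nonneg (abs_nonneg w) _)]
      exact mul_le_mul_of_nonneg_right
        (Real.rpow_le_rpow (abs_nonneg _) hw (by linarith)) (abs_nonneg _)
    have h4 := hb u (le_max_left _ _)
    have h5 := hb v (le_max_right _ _)
    have h6 : 0 ≤ max |u| |v| ^ (s - 1) * (|u| + |v|) := by positivity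
    simp only [h0]
    nlinarith

/-- First-order Taylor expansion of `|x|^p`, with a bound on the oscillation of the derivative. -/
theorem abs_add_rpow_le_of_signedPow_sub_le {p : ℝ} (hp : 1 < p) {x y B : ℝ}
    (hB : ∀ u, |u - x| ≤ |y| → |signedPow (p - 1) u - signedPow (p - 1) x| ≤ B) :
    |x + y| ^ p ≤ |x| ^ p + p * signedPow (p - 1) x * y + p * (B * |y|) := by
  -- Mean value inequality for `|t| ^ p` minus its tangent direction at `x`: the derivative is `p`
  -- times the increment of the signed power, at most `p * B` along the segment.
  have hder : ∀ u, HasDerivAt (fun t => |t| ^ p - p * signedPow (p - 1) x * t)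
      (p * (signedPow (p - 1) u - signedPow (p - 1) x)) u := by
    intro u
    have h1 := (hasDerivAt_abs_rpow u hp).sub ((hasDerivAt_id u).const_mul
      (p * signedPow (p - 1) x))
    refine h1.congr_deriv ?_
    simp only [signedPow]
    rw [show p - 1 - 1 = p - 2 by ring]
    ring
  have hseg : ∀ u ∈ segment ℝ x (x + y), |u - x| ≤ |y| := by
    rintro u hu
    rw [segment_eq_image'] at hu
    obtain ⟨θ, ⟨h0, h1⟩, rfl⟩ := hu
    simp only [add_sub_cancel_left, smul_eq_mul, abs_mul, abs_of_nonneg h0]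
    nlinarith [abs_nonneg y]
  have := (convex_segment x (x + y)).norm_image_sub_le_of_norm_hasDerivWithin_le (C := p * B)
    (fun u _ => (hder u).hasDerivWithinAt)
    (fun u hu => by
      rw [Real.norm_eq_abs, abs_mul, abs_of_pos (by linarith : 0 < p)]
      exact mul_le_mul_of_nonneg_left (hB u (hseg u hu)) (by linarith))
    (left_mem_segment ℝ x (x + y)) (right_mem_segment ℝ x (x + y))
  rw [Real.norm_eq_abs, Real.norm_eq_abs, add_sub_cancel_left] at this
  have := (le_abs_self _).trans this
  linarith

theorem abs_add_rpow_le_of_le_two {p : ℝ} (hp : 1 < p) (hp2 : p ≤ 2) (x y : ℝ) :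
    |x + y| ^ p ≤ |x| ^ p + p * signedPow (p - 1) x * y + 4 * |y| ^ p := by
  have h := abs_add_rpow_le_of_signedPow_sub_le hp (x := x) (y := y) (B := 2 * |y| ^ (p - 1))
    fun u hu => (abs_signedPow_sub_le_of_le_one (by linarith) (by linarith) u x).trans
      (by gcongr)
  have h2 : |y| ^ (p - 1) * |y| = |y| ^ p := by
    rw [← Real.rpow_add_one' (abs_nonneg y) (by linarith), sub_add_cancel]
  have h3 : 0 ≤ |y| ^ p := by positivity
  nlinarith

/-- The derivative's oscillation is of order `max(|u|, |x|) ^ (r - 2) * |y|`. As `r - 2 ≤ 1`,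
subadditivity splits this power of `|x| + |y|` with no further constant; `6` bounds `2 * r`. -/
theorem abs_add_rpow_le_of_two_lt {r : ℝ} (hr : 2 < r) (hr3 : r ≤ 3) (x y : ℝ) :
    |x + y| ^ r ≤ |x| ^ r + r * signedPow (r - 1) x * y
      + 6 * (|x| ^ (r - 2) * |y| ^ (2 : ℝ) + |y| ^ r) := by
  have h := abs_add_rpow_le_of_signedPow_sub_le (by linarith : 1 < r) (x := x) (y := y)
    (B := 2 * ((|x| ^ (r - 2) + |y| ^ (r - 2)) * |y|))
    fun u hu => by
      refine (abs_signedPow_sub_le_of_one_le (by linarith) u x).trans ?_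
      have hu' : |u| ≤ |x| + |y| := by
        have := abs_sub_abs_le_abs_sub u x
        linarith
      have h1 : max |u| |x| ^ (r - 1 - 1) ≤ |x| ^ (r - 2) + |y| ^ (r - 2) := by
        rw [show r - 1 - 1 = r - 2 by ring]
        refine le_trans (Real.rpow_le_rpow (by positivity)
          (max_le hu' (by linarith [abs_nonneg y])) (by linarith)) ?_
        exact Real.rpow_add_le_add_rpow (abs_nonneg _) (abs_nonneg _) (by linarith) (by linarith)
      have h0 : (0 : ℝ) ≤ (|x| ^ (r - 2) + |y| ^ (r - 2)) * |y| := by positivity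
      calc (r - 1) * (max |u| |x| ^ (r - 1 - 1) * |u - x|)
          ≤ (r - 1) * ((|x| ^ (r - 2) + |y| ^ (r - 2)) * |y|) := by
            have : 0 ≤ r - 1 := by linarith
            gcongr
        _ ≤ _ := by nlinarith
  have h2 : |y| ^ (r - 2) * |y| * |y| = |y| ^ r := by
    rw [← Real.rpow_add_one' (abs_nonneg y) (by linarith),
      ← Real.rpow_add_one' (abs_nonneg y) (by linarith)]
    congr 1; ring
  rw [Real.rpow_two]
  have h3 : 0 ≤ |y| ^ r := by positivity
  have h4 : 0 ≤ |x| ^ (r - 2) * |y| ^ 2 := by positivity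
  have h5 : 2 * ((|x| ^ (r - 2) + |y| ^ (r - 2)) * |y|) * |y|
      = 2 * (|x| ^ (r - 2) * |y| ^ 2 + |y| ^ r) := by rw [← h2]; ring
  rw [h5] at h
  nlinarith

/-! ### Quantitative `L^r` bounds -/

section LpBound

variable {Ω : Type*} [mΩ : MeasurableSpace Ω] {Pr : Measure Ω} {r p K L : ℝ} {f g : Ω → ℝ}

/-- `f` is in `L^r`, with norm at most `K`. -/
structure LpBound (Pr : Measure Ω) (r : ℝ) (f : Ω → ℝ) (K : ℝ) : Prop where
  aesm : AEStronglyMeasurable f Pr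
  nonneg : 0 ≤ K
  le : eLpNorm f (ENNReal.ofReal r) Pr ≤ ENNReal.ofReal K

namespace LpBound

theorem memLp (hf : LpBound Pr r f K) : MemLp f (ENNReal.ofReal r) Pr :=
  ⟨hf.aesm, hf.le.trans_lt ENNReal.ofReal_lt_top⟩

theorem mono (hf : LpBound Pr r f K) (h : K ≤ L) : LpBound Pr r f L :=
  ⟨hf.aesm, hf.nonneg.trans h, hf.le.trans (ENNReal.ofReal_le_ofReal h)⟩

theorem congr (hf : LpBound Pr r f K) (h : ∀ ω, g ω = f ω) : LpBound Pr r g K := by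
  rwa [show g = f from funext h]

theorem zero (Pr : Measure Ω) (r : ℝ) : LpBound Pr r (fun _ => 0) 0 :=
  ⟨aestronglyMeasurable_const, le_rfl, by simp⟩

theorem add (hr : 1 ≤ r) (hf : LpBound Pr r f K) (hg : LpBound Pr r g L) :
    LpBound Pr r (fun ω => f ω + g ω) (K + L) := by
  refine ⟨hf.aesm.add hg.aesm, add_nonneg hf.nonneg hg.nonneg, ?_⟩
  rw [ENNReal.ofReal_add hf.nonneg hg.nonneg]
  exact (eLpNorm_add_le hf.aesm hg.aesm (by simpa using hr)).trans (add_le_add hf.le hg.le)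

theorem const_mul (a : ℝ) (hf : LpBound Pr r f K) :
    LpBound Pr r (fun ω => a * f ω) (|a| * K) := by
  refine ⟨hf.aesm.const_mul a, mul_nonneg (abs_nonneg _) hf.nonneg, ?_⟩
  rw [ENNReal.ofReal_mul (abs_nonneg _), ← Real.enorm_eq_ofReal_abs]
  exact (eLpNorm_const_smul a f _ Pr).le.trans (mul_le_mul_right hf.le _)

theorem neg (hf : LpBound Pr r f K) : LpBound Pr r (fun ω => -f ω) K := by
  simpa using hf.const_mul (-1)

theorem sub (hr : 1 ≤ r) (hf : LpBound Pr r f K) (hg : LpBound Pr r g L) :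
    LpBound Pr r (fun ω => f ω - g ω) (K + L) := by
  simpa only [sub_eq_add_neg] using hf.add hr hg.neg

theorem sum (hr : 1 ≤ r) {ι : Type*} {s : Finset ι} {f : ι → Ω → ℝ} {K : ι → ℝ}
    (h : ∀ i ∈ s, LpBound Pr r (f i) (K i)) :
    LpBound Pr r (fun ω => ∑ i ∈ s, f i ω) (∑ i ∈ s, K i) := by
  classical
  induction s using Finset.induction_on with
  | empty => simpa using LpBound.zero Pr r
  | insert i s hi ih =>
    simp only [Finset.sum_insert hi]
    exact (h i (Finset.mem_insert_self _ _)).add hr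
      (ih fun j hj => h j (Finset.mem_insert_of_mem hj))

theorem sum_const_mul (hr : 1 ≤ r) {ι : Type*} {s : Finset ι} {f : ι → Ω → ℝ} {a : ι → ℝ}
    (h : ∀ i ∈ s, LpBound Pr r (f i) K) :
    LpBound Pr r (fun ω => ∑ i ∈ s, a i * f i ω) ((∑ i ∈ s, |a i|) * K) := by
  rw [Finset.sum_mul]
  exact LpBound.sum hr fun i hi => (h i hi).const_mul (a i)

/-- Hölder with exponents `2p, 2p, p`. All terms to be bounded are quadratic in the chain, which is
why moments of order `2p` are carried throughout. -/
theorem mul (hp : 1 ≤ p) (hf : LpBound Pr (2 * p) f K) (hg : LpBound Pr (2 * p) g L) :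
    LpBound Pr p (fun ω => f ω * g ω) (K * L) := by
  have hp0 : 0 < p := by linarith
  have : (ENNReal.ofReal (2 * p)).HolderTriple (ENNReal.ofReal (2 * p)) (ENNReal.ofReal p) := by
    constructor
    rw [← ENNReal.ofReal_inv_of_pos (by positivity), ← ENNReal.ofReal_inv_of_pos hp0,
      ← ENNReal.ofReal_add (by positivity) (by positivity)]
    congr 1
    field_simp
    norm_num
  refine ⟨hf.aesm.mul hg.aesm, mul_nonneg hf.nonneg hg.nonneg, ?_⟩
  rw [ENNReal.ofReal_mul hf.nonneg]
  exact (eLpNorm_smul_le_mul_eLpNorm (r := ENNReal.ofReal p) hg.aesm hf.aesm).trans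
    (mul_le_mul' hf.le hg.le)

theorem integrable_rpow (hr : 0 < r) (hf : MemLp f (ENNReal.ofReal r) Pr) :
    Integrable (fun ω => |f ω| ^ r) Pr := by
  have := hf.integrable_norm_rpow (by simpa using hr) ENNReal.ofReal_ne_top
  rwa [ENNReal.toReal_ofReal hr.le] at this

/-- Passage between the norm form, suited to the triangle and Hölder inequalities, and the moment
form, in which the martingale inductions run. -/
theorem iff_integral (hr : 0 < r) : LpBound Pr r f K ↔
    MemLp f (ENNReal.ofReal r) Pr ∧ 0 ≤ K ∧ ∫ ω, |f ω| ^ r ∂Pr ≤ K ^ r := by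
  have key : MemLp f (ENNReal.ofReal r) Pr → 0 ≤ K →
      (eLpNorm f (ENNReal.ofReal r) Pr ≤ ENNReal.ofReal K ↔ ∫ ω, |f ω| ^ r ∂Pr ≤ K ^ r) := by
    intro hf hK
    rw [hf.eLpNorm_eq_integral_rpow_norm (by simpa using hr) ENNReal.ofReal_ne_top,
      ENNReal.toReal_ofReal hr.le, ENNReal.ofReal_le_ofReal_iff hK]
    simp only [Real.norm_eq_abs]
    exact Real.rpow_inv_le_iff_of_pos (integral_nonneg fun _ => by positivity) hK hr
  constructor
  · intro h
    exact ⟨h.memLp, h.nonneg, (key h.memLp h.nonneg).1 h.le⟩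
  · rintro ⟨h1, h2, h3⟩
    exact ⟨h1.1, h2, (key h1 h2).2 h3⟩

end LpBound

end LpBound

/-! ### Martingale differences -/

section MartingaleDifference

variable {Ω : Type*} [mΩ : MeasurableSpace Ω] {Pr : Measure Ω} {F : Filtration ℕ mΩ}
  {d : ℕ → Ω → ℝ}

/-- `d` is adapted, and `d (j + 1)` is orthogonal to the past up to time `j`. -/
structure IsMartingaleDifference (F : Filtration ℕ mΩ) (Pr : Measure Ω) (d : ℕ → Ω → ℝ) :
    Prop where
  adapted : ∀ j, StronglyMeasurable[F j] (d j)
  orthogonal : ∀ j Z, StronglyMeasurable[F j] Z → Integrable (fun ω => Z ω * d (j + 1) ω) Pr →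
    ∫ ω, Z ω * d (j + 1) ω ∂Pr = 0

namespace IsMartingaleDifference

/-- Orthogonality is tested against every `Z` for which the product is integrable, so a predictable
factor is absorbed into `Z` and needs no integrability of its own. -/
theorem predictable_mul (hd : IsMartingaleDifference F Pr d) {Y : ℕ → Ω → ℝ}
    (h0 : StronglyMeasurable[F 0] (Y 0)) (hY : ∀ j, StronglyMeasurable[F j] (Y (j + 1))) :
    IsMartingaleDifference F Pr fun j ω => Y j ω * d j ω where
  adapted j := by
    refine StronglyMeasurable.mul ?_ (hd.adapted j)
    cases j with
    | zero => exact h0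
    | succ j => exact (hY j).mono (F.mono j.le_succ)
  orthogonal j Z hZ hi := by
    simp only [← mul_assoc] at hi ⊢
    exact hd.orthogonal j (fun ω => Z ω * Y (j + 1) ω) (hZ.mul (hY j)) hi

theorem const_mul (hd : IsMartingaleDifference F Pr d) (α : ℕ → ℝ) :
    IsMartingaleDifference F Pr fun j ω => α j * d j ω :=
  hd.predictable_mul (Y := fun j _ => α j) stronglyMeasurable_const
    fun _ => stronglyMeasurable_const

theorem stronglyMeasurable_sum (hd : IsMartingaleDifference F Pr d) (n : ℕ) :
    StronglyMeasurable[F n] fun ω => ∑ j ∈ Finset.Icc 1 n, d j ω :=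
  Finset.stronglyMeasurable_fun_sum _ fun j hj =>
    (hd.adapted j).mono (F.mono (Finset.mem_Icc.1 hj).2)

theorem martingale_sum [IsFiniteMeasure Pr] (hd : IsMartingaleDifference F Pr d)
    (hi : ∀ j, 1 ≤ j → Integrable (d j) Pr) :
    Martingale (fun n ω => ∑ j ∈ Finset.Icc 1 n, d j ω) F Pr := by
  have hint : ∀ n, Integrable (fun ω => ∑ j ∈ Finset.Icc 1 n, d j ω) Pr := fun n =>
    integrable_finsetSum _ fun j hj => hi j (Finset.mem_Icc.1 hj).1
  refine martingale_nat hd.stronglyMeasurable_sum hint fun n => ?_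
  refine ae_eq_condExp_of_forall_setIntegral_eq (F.le n) (hint _)
    (fun s _ _ => (hint n).integrableOn) (fun s hs _ => ?_)
    ((hd.stronglyMeasurable_sum n).aestronglyMeasurable)
  simp only [Finset.sum_Icc_succ_top (Nat.le_add_left 1 n)]
  rw [integral_add (hint n).integrableOn (hi _ (Nat.le_add_left 1 n)).integrableOn]
  -- Testing against indicators of past events gives the defining set integrals of the conditional
  -- expectation.
  have h1 := hd.orthogonal n (s.indicator fun _ => (1 : ℝ))
    (stronglyMeasurable_const.indicator hs)
  have h2 : (fun ω => s.indicator (fun _ => (1 : ℝ)) ω * d (n + 1) ω)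
      = s.indicator (d (n + 1)) := by
    ext ω
    by_cases h : ω ∈ s <;> simp [h]
  rw [h2, integral_indicator (F.le n _ hs)] at h1
  rw [h1 ((hi _ (Nat.le_add_left 1 n)).indicator (F.le n _ hs)), add_zero]

end IsMartingaleDifference

theorem rpow_mul_rpow_le_add {a b s t : ℝ} (ha : 0 ≤ a) (hb : 0 ≤ b) (hs : 0 < s) (ht : 0 < t) :
    a ^ s * b ^ t ≤ a ^ (s + t) + b ^ (s + t) := by
  have h1 := Real.rpow_nonneg ha (s + t)
  have h2 := Real.rpow_nonneg hb (s + t)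
  rcases le_total a b with h | h
  · calc a ^ s * b ^ t ≤ b ^ s * b ^ t := by gcongr
      _ = b ^ (s + t) := (Real.rpow_add_of_nonneg hb hs.le ht.le).symm
      _ ≤ _ := by linarith
  · calc a ^ s * b ^ t ≤ a ^ s * a ^ t := by gcongr
      _ = a ^ (s + t) := (Real.rpow_add_of_nonneg ha hs.le ht.le).symm
      _ ≤ _ := by linarith

theorem integrable_rpow_mul_rpow {f g : Ω → ℝ} {s t r : ℝ} (hs : 0 < s) (ht : 0 < t)
    (hst : s + t = r) (hf : MemLp f (ENNReal.ofReal r) Pr) (hg : MemLp g (ENNReal.ofReal r) Pr) :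
    Integrable (fun ω => |f ω| ^ s * |g ω| ^ t) Pr := by
  have hr : 0 < r := by linarith
  refine Integrable.mono' ((LpBound.integrable_rpow hr hf).add (LpBound.integrable_rpow hr hg))
    ?_ (ae_of_all _ fun ω => ?_)
  · have h1 := hf.1.aemeasurable
    have h2 := hg.1.aemeasurable
    exact ((h1.abs.pow_const s).mul (h2.abs.pow_const t)).aestronglyMeasurable
  · rw [Real.norm_eq_abs, abs_of_nonneg (by positivity)]
    simpa [hst] using rpow_mul_rpow_le_add (abs_nonneg (f ω)) (abs_nonneg (g ω)) hs ht

theorem integrable_signedPow_mul {f g : Ω → ℝ} {r : ℝ} (hr : 1 < r)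
    (hf : MemLp f (ENNReal.ofReal r) Pr) (hg : MemLp g (ENNReal.ofReal r) Pr) :
    Integrable (fun ω => signedPow (r - 1) (f ω) * g ω) Pr := by
  refine (integrable_rpow_mul_rpow (s := r - 1) (t := 1) (by linarith) one_pos (by ring)
    hf hg).mono ?_ (ae_of_all _ fun ω => ?_)
  · exact (((measurable_signedPow _).comp_aemeasurable hf.1.aemeasurable).mul
      hg.1.aemeasurable).aestronglyMeasurable
  · rw [Real.norm_eq_abs, Real.norm_eq_abs, abs_mul, abs_signedPow (by linarith), Real.rpow_one,
      abs_of_nonneg (a := |f ω| ^ (r - 1) * |g ω|) (by positivity)]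

/-- The von Bahr–Esseen inequality. -/
theorem IsMartingaleDifference.lpBound_sum_of_le_two {p K : ℝ} (hp : 1 < p) (hp2 : p ≤ 2)
    (hd : IsMartingaleDifference F Pr d) (n : ℕ) (hK0 : 0 ≤ K)
    (hK : ∀ j ∈ Finset.Icc 1 n, LpBound Pr p (d j) K) :
    LpBound Pr p (fun ω => ∑ j ∈ Finset.Icc 1 n, d j ω) (4 * (n : ℝ) ^ (1 / p) * K) := by
  have hp0 : 0 < p := by linarith
  have key : ∀ m ≤ n, MemLp (fun ω => ∑ j ∈ Finset.Icc 1 m, d j ω) (ENNReal.ofReal p) Pr ∧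
      ∫ ω, |∑ j ∈ Finset.Icc 1 m, d j ω| ^ p ∂Pr ≤ m * (4 * K ^ p) := by
    intro m hm
    have hmem : ∀ m ≤ n, MemLp (fun ω => ∑ j ∈ Finset.Icc 1 m, d j ω) (ENNReal.ofReal p) Pr :=
      fun m hm => (LpBound.sum hp.le fun j hj => hK j (Finset.mem_Icc.2
        ⟨(Finset.mem_Icc.1 hj).1, (Finset.mem_Icc.1 hj).2.trans hm⟩)).memLp
    refine ⟨hmem m hm, ?_⟩
    induction m with
    | zero => simp [Real.zero_rpow hp0.ne']
    | succ m ih =>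
      specialize ih (by omega)
      have hS := hmem m (by omega)
      have hdm := hK (m + 1) (Finset.mem_Icc.2 ⟨by omega, hm⟩)
      simp only [Finset.sum_Icc_succ_top (Nat.le_add_left 1 m)]
      set S : Ω → ℝ := fun ω => ∑ j ∈ Finset.Icc 1 m, d j ω with hSdef
      have hI1 := LpBound.integrable_rpow hp0 hS
      have hI2 := integrable_signedPow_mul hp hS hdm.memLp
      have hI3 := LpBound.integrable_rpow hp0 hdm.memLp
      -- The linear Taylor term: the signed power of the past sum is measurable with respect to the
      -- past, so its product with the next difference has zero mean.
      have hz := hd.orthogonal m (fun ω => signedPow (p - 1) (S ω))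
        ((measurable_signedPow _).comp (hd.stronglyMeasurable_sum m).measurable).stronglyMeasurable
        hI2
      have hd3 := ((LpBound.iff_integral hp0).1 hdm).2.2
      calc ∫ ω, |S ω + d (m + 1) ω| ^ p ∂Pr
          ≤ ∫ ω, (|S ω| ^ p + p * (signedPow (p - 1) (S ω) * d (m + 1) ω)
              + 4 * |d (m + 1) ω| ^ p) ∂Pr := by
            refine integral_mono (LpBound.integrable_rpow hp0 (hS.add hdm.memLp))
              ((hI1.add (hI2.const_mul p)).add (hI3.const_mul 4)) fun ω => ?_
            have := abs_add_rpow_le_of_le_two hp hp2 (S ω) (d (m + 1) ω)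
            rwa [mul_assoc p] at this
        _ = ∫ ω, |S ω| ^ p ∂Pr + 4 * ∫ ω, |d (m + 1) ω| ^ p ∂Pr := by
            have hI12 : Integrable (fun ω => |S ω| ^ p
                + p * (signedPow (p - 1) (S ω) * d (m + 1) ω)) Pr := hI1.add (hI2.const_mul p)
            rw [integral_add hI12 (hI3.const_mul 4),
              integral_add hI1 (hI2.const_mul p), integral_const_mul, integral_const_mul, hz]
            ring
        _ ≤ _ := by push_cast; nlinarith
  rw [LpBound.iff_integral hp0]
  refine ⟨(key n le_rfl).1, by positivity, (key n le_rfl).2.trans ?_⟩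
  rw [Real.mul_rpow (by positivity) hK0, Real.mul_rpow (by positivity) (by positivity),
    ← Real.rpow_mul (by positivity), one_div_mul_cancel hp0.ne', Real.rpow_one]
  -- The induction has the constant `4` on the `p`-th moment; the claim has it outside the `p`-th
  -- root.
  have h4 : (4 : ℝ) ≤ 4 ^ p := by
    simpa using Real.rpow_le_rpow_of_exponent_le (by norm_num : (1 : ℝ) ≤ 4) hp.le
  have : 0 ≤ n * K ^ p := by positivity
  nlinarith

/-- Hölder with exponents `r / (r - 2)` and `r / 2`, for the mixed Taylor remainder. -/
theorem integral_rpow_sub_two_mul_sq_le {f g : Ω → ℝ} {r K L : ℝ} (hr : 2 < r)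
    (hf : LpBound Pr r f K) (hg : LpBound Pr r g L) :
    ∫ ω, |f ω| ^ (r - 2) * |g ω| ^ (2 : ℝ) ∂Pr ≤ K ^ (r - 2) * L ^ 2 := by
  have hr0 : 0 < r := by linarith
  have hr2 : 0 < r - 2 := by linarith
  have hpq : (r / (r - 2)).HolderConjugate (r / 2) := by
    rw [Real.holderConjugate_iff]
    refine ⟨(one_lt_div hr2).2 (by linarith), ?_⟩
    field_simp
    ring
  have hmem : ∀ {f : Ω → ℝ} {s : ℝ}, 0 < s → MemLp f (ENNReal.ofReal r) Pr →
      MemLp (fun ω => |f ω| ^ s) (ENNReal.ofReal (r / s)) Pr := by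
    intro f s hs hf
    have := hf.norm_rpow_div (ENNReal.ofReal s)
    rwa [ENNReal.toReal_ofReal hs.le, ← ENNReal.ofReal_div_of_pos hs] at this
  have h := integral_mul_le_Lp_mul_Lq_of_nonneg hpq
    (f := fun ω => |f ω| ^ (r - 2)) (g := fun ω => |g ω| ^ (2 : ℝ))
    (ae_of_all _ fun ω => by positivity) (ae_of_all _ fun ω => by positivity)
    (hmem hr2 hf.memLp) (hmem two_pos hg.memLp)
  refine h.trans ?_
  have e1 : ∀ x : ℝ, (|x| ^ (r - 2)) ^ (r / (r - 2)) = |x| ^ r := fun x => by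
    rw [← Real.rpow_mul (abs_nonneg x)]; congr 1; field_simp
  have e2 : ∀ x : ℝ, (|x| ^ (2 : ℝ)) ^ (r / 2) = |x| ^ r := fun x => by
    rw [← Real.rpow_mul (abs_nonneg x)]; congr 1; field_simp
  simp only [e1, e2]
  have b1 := ((LpBound.iff_integral hr0).1 hf).2.2
  have b2 := ((LpBound.iff_integral hr0).1 hg).2.2
  have c1 : (K ^ r) ^ (1 / (r / (r - 2))) = K ^ (r - 2) := by
    rw [← Real.rpow_mul hf.nonneg]; congr 1; field_simp
  have c2 : (L ^ r) ^ (1 / (r / 2)) = L ^ 2 := by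
    rw [← Real.rpow_mul hg.nonneg, ← Real.rpow_two]; congr 1; field_simp
  rw [← c1, ← c2]
  have n1 : 0 ≤ ∫ ω, |f ω| ^ r ∂Pr := integral_nonneg fun _ => by positivity
  have n2 : 0 ≤ ∫ ω, |g ω| ^ r ∂Pr := integral_nonneg fun _ => by positivity
  have n3 : 0 ≤ K ^ r := n1.trans b1
  gcongr

/-- Average of two lower bounds for `(a + x) ^ s`: superadditivity, and `(a + x) ^ (s - 1) ≥ a ^ (s
- 1)` multiplied by `a + x`. It closes the induction below, with `s = r / 2`. -/
theorem rpow_add_half_le {a x s : ℝ} (ha : 0 ≤ a) (hx : 0 ≤ x) (hs : 1 < s) :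
    a ^ s + (a ^ (s - 1) * x + x ^ s) / 2 ≤ (a + x) ^ s := by
  have h1 := Real.add_rpow_le_rpow_add ha hx hs.le
  have h2 : a ^ s + a ^ (s - 1) * x ≤ (a + x) ^ s := by
    have e : ∀ y : ℝ, 0 ≤ y → y ^ s = y ^ (s - 1) * y := fun y hy => by
      rw [← Real.rpow_add_one' hy (by linarith), sub_add_cancel]
    rw [e a ha, e (a + x) (by positivity), ← mul_add]
    gcongr
    linarith
  linarith

/-- A Burkholder-type inequality: the `L^r` norm of a martingale is at most the square root of
the sum of the squared norms of its increments, up to a constant. -/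
theorem IsMartingaleDifference.lpBound_sum_of_two_lt {r : ℝ} (hr : 2 < r) (hr3 : r ≤ 3)
    (hd : IsMartingaleDifference F Pr d) (n : ℕ) {K : ℕ → ℝ}
    (hK : ∀ j ∈ Finset.Icc 1 n, LpBound Pr r (d j) (K j)) :
    LpBound Pr r (fun ω => ∑ j ∈ Finset.Icc 1 n, d j ω)
      (4 * √(∑ j ∈ Finset.Icc 1 n, K j ^ 2)) := by
  have hr0 : 0 < r := by linarith
  have key : ∀ m ≤ n, LpBound Pr r (fun ω => ∑ j ∈ Finset.Icc 1 m, d j ω)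
      (√(12 * ∑ j ∈ Finset.Icc 1 m, K j ^ 2)) := by
    intro m hm
    induction m with
    | zero => simpa using LpBound.zero Pr r
    | succ m ih =>
      specialize ih (by omega)
      have hS := ih.memLp
      have hdm := hK (m + 1) (Finset.mem_Icc.2 ⟨by omega, hm⟩)
      rw [LpBound.iff_integral hr0]
      refine ⟨?_, Real.sqrt_nonneg _, ?_⟩
      · simp only [Finset.sum_Icc_succ_top (Nat.le_add_left 1 m)]
        exact hS.add hdm.memLp
      simp only [Finset.sum_Icc_succ_top (Nat.le_add_left 1 m)]
      set S : Ω → ℝ := fun ω => ∑ j ∈ Finset.Icc 1 m, d j ω with hSdef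
      -- The factor `12` is twice the Taylor constant `6`: with `x = 12 * k ^ 2`, the half in
      -- `rpow_add_half_le` leaves exactly `6` in front of the mixed remainder.
      set A : ℝ := 12 * ∑ j ∈ Finset.Icc 1 m, K j ^ 2 with hA
      have hA0 : 0 ≤ A := by positivity
      have hI1 := LpBound.integrable_rpow hr0 hS
      have hI2 := integrable_signedPow_mul (by linarith : 1 < r) hS hdm.memLp
      have hI3 := LpBound.integrable_rpow hr0 hdm.memLp
      have hI4 := integrable_rpow_mul_rpow (s := r - 2) (t := 2) (by linarith) two_pos (by ring)
        hS hdm.memLp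
      have hz := hd.orthogonal m (fun ω => signedPow (r - 1) (S ω))
        ((measurable_signedPow _).comp (hd.stronglyMeasurable_sum m).measurable).stronglyMeasurable
        hI2
      have hd3 := ((LpBound.iff_integral hr0).1 hdm).2.2
      have hS3 := ((LpBound.iff_integral hr0).1 ih).2.2
      have hm3 := integral_rpow_sub_two_mul_sq_le hr ih hdm
      have es : ∀ y t : ℝ, 0 ≤ y → √y ^ t = y ^ (t / 2) := fun y t hy => by
        rw [Real.sqrt_eq_rpow, ← Real.rpow_mul hy]; congr 1; ring
      rw [es _ _ hA0] at hS3 hm3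
      set k : ℝ := K (m + 1) with hk
      have hk0 : 0 ≤ k := hdm.nonneg
      have hadd : 12 * (∑ j ∈ Finset.Icc 1 m, K j ^ 2 + k ^ 2) = A + 12 * k ^ 2 := by
        rw [hA]; ring
      rw [hadd, es _ _ (by positivity)]
      have hkr : 12 * k ^ r ≤ (12 * k ^ 2) ^ (r / 2) := by
        rw [Real.mul_rpow (by norm_num) (by positivity), ← Real.rpow_two, ← Real.rpow_mul hk0,
          mul_div_cancel₀ r two_ne_zero]
        gcongr
        simpa using Real.rpow_le_rpow_of_exponent_le (by norm_num : (1 : ℝ) ≤ 12)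
          (by linarith : (1 : ℝ) ≤ r / 2)
      have hfin := rpow_add_half_le hA0 (by positivity : 0 ≤ 12 * k ^ 2)
        (by linarith : 1 < r / 2)
      rw [show (r - 2) / 2 = r / 2 - 1 by ring] at hm3
      calc ∫ ω, |S ω + d (m + 1) ω| ^ r ∂Pr
          ≤ ∫ ω, (|S ω| ^ r + r * (signedPow (r - 1) (S ω) * d (m + 1) ω)
              + 6 * (|S ω| ^ (r - 2) * |d (m + 1) ω| ^ (2 : ℝ) + |d (m + 1) ω| ^ r)) ∂Pr := by
            refine integral_mono (LpBound.integrable_rpow hr0 (hS.add hdm.memLp))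
              ((hI1.add (hI2.const_mul r)).add ((hI4.add hI3).const_mul 6)) fun ω => ?_
            have := abs_add_rpow_le_of_two_lt hr hr3 (S ω) (d (m + 1) ω)
            rwa [mul_assoc r] at this
        _ = ∫ ω, |S ω| ^ r ∂Pr + 6 * (∫ ω, |S ω| ^ (r - 2) * |d (m + 1) ω| ^ (2 : ℝ) ∂Pr
              + ∫ ω, |d (m + 1) ω| ^ r ∂Pr) := by
            have hI12 : Integrable (fun ω => |S ω| ^ r
                + r * (signedPow (r - 1) (S ω) * d (m + 1) ω)) Pr := hI1.add (hI2.const_mul r)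
            have hI43 : Integrable (fun ω => |S ω| ^ (r - 2) * |d (m + 1) ω| ^ (2 : ℝ)
                + |d (m + 1) ω| ^ r) Pr := hI4.add hI3
            rw [integral_add hI12 (hI43.const_mul 6),
              integral_add hI1 (hI2.const_mul r), integral_const_mul, integral_const_mul, hz,
              integral_add hI4 hI3]
            ring
        _ ≤ _ := by nlinarith
  refine (key n le_rfl).mono ?_
  rw [Real.sqrt_mul (by norm_num)]
  gcongr
  rw [Real.sqrt_le_left (by norm_num)]
  norm_num

end MartingaleDifference

/-! ### Summation identities -/

section Algebra

theorem sum_Icc_telescope (f : ℕ → ℝ) (n : ℕ) :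
    ∑ j ∈ Finset.Icc 1 n, (f j - f (j - 1)) = f n - f 0 := by
  induction n with
  | zero => simp
  | succ n ih => rw [Finset.sum_Icc_succ_top (Nat.le_add_left 1 n), ih]; simp

theorem sum_Icc_lag (f : ℤ → ℝ) (l : ℕ) :
    ∑ j ∈ Finset.Icc 1 l, f (l - j) = ∑ k ∈ Finset.range l, f k := by
  refine Finset.sum_nbij' (fun j => l - j) (fun k => l - k) ?_ ?_ ?_ ?_ ?_
  · intro j hj; simp only [Finset.mem_Icc, Finset.mem_range] at *; omega
  · intro j hj; simp only [Finset.mem_Icc, Finset.mem_range] at *; omega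
  · intro j hj; simp only [Finset.mem_Icc] at *; omega
  · intro j hj; simp only [Finset.mem_range] at *; omega
  · intro j hj
    simp only [Finset.mem_Icc] at hj
    rw [Nat.cast_sub hj.2]

/-- Reindexing pairs by lag and position, with `l = k + j`. -/
theorem sum_lag_eq (f : ℕ → ℕ → ℝ) (n : ℕ) :
    ∑ k ∈ Finset.Icc 1 (n - 1), ∑ j ∈ Finset.Icc 1 (n - k), f k j
      = ∑ l ∈ Finset.Icc 1 n, ∑ j ∈ Finset.Icc 1 (l - 1), f (l - j) j := by
  rw [Finset.sum_sigma', Finset.sum_sigma']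
  refine Finset.sum_nbij' (fun x => ⟨x.1 + x.2, x.2⟩) (fun x => ⟨x.1 - x.2, x.2⟩) ?_ ?_ ?_ ?_ ?_
  · rintro ⟨k, j⟩ h; simp only [Finset.mem_sigma, Finset.mem_Icc] at *; omega
  · rintro ⟨k, j⟩ h; simp only [Finset.mem_sigma, Finset.mem_Icc] at *; omega
  · rintro ⟨k, j⟩ h; simp
  · rintro ⟨k, j⟩ h
    simp only [Finset.mem_sigma, Finset.mem_Icc] at *
    simp only [Sigma.mk.injEq, heq_eq_eq, and_true]
    omega
  · rintro ⟨k, j⟩ h; simp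

theorem sum_mul_sum_lower (y v : ℕ → ℝ) (n : ℕ) :
    ∑ j ∈ Finset.Icc 1 (n - 1), y j * ∑ k ∈ Finset.Icc 1 (n - j), v k
      = ∑ k ∈ Finset.Icc 1 (n - 1), v k * ∑ j ∈ Finset.Icc 1 (n - k), y j := by
  simp only [Finset.mul_sum]
  rw [Finset.sum_comm' (t' := Finset.Icc 1 (n - 1)) (s' := fun k => Finset.Icc 1 (n - k))]
  · simp only [mul_comm]
  · intro j k; simp only [Finset.mem_Icc]; omega

theorem sum_Icc_shift (y : ℕ → ℝ) {n k : ℕ} (hk : k ≤ n) :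
    ∑ j ∈ Finset.Icc 1 (n - k), y (j + k)
      = ∑ j ∈ Finset.Icc 1 n, y j - ∑ j ∈ Finset.Icc 1 k, y j := by
  obtain ⟨m, rfl⟩ := Nat.exists_eq_add_of_le hk
  rw [Nat.add_sub_cancel_left]
  induction m with
  | zero => simp
  | succ m ih =>
    rw [Finset.sum_Icc_succ_top (Nat.le_add_left 1 m), ← add_assoc,
      Finset.sum_Icc_succ_top (Nat.le_add_left 1 (k + m)), ih (by omega),
      show m + 1 + k = k + m + 1 by ring]
    ring

theorem sum_mul_sum_upper (y v : ℕ → ℝ) (n : ℕ) :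
    ∑ j ∈ Finset.Icc 2 n, y j * ∑ k ∈ Finset.Icc 1 (j - 1), v k
      = ∑ k ∈ Finset.Icc 1 (n - 1), v k * ∑ j ∈ Finset.Icc 1 (n - k), y (j + k) := by
  have h1 : ∑ j ∈ Finset.Icc 2 n, y j * ∑ k ∈ Finset.Icc 1 (j - 1), v k
      = ∑ j ∈ Finset.Icc 1 n, y j * ∑ k ∈ Finset.Icc 1 (j - 1), v k := by
    refine Finset.sum_subset (Finset.Icc_subset_Icc_left one_le_two) fun j hj hj' => ?_
    simp only [Finset.mem_Icc] at hj hj'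
    obtain rfl : j = 1 := by omega
    simp
  rw [h1]
  simp only [Finset.mul_sum]
  rw [sum_lag_eq (fun k j => v k * y (j + k))]
  refine Finset.sum_congr rfl fun l hl => ?_
  refine Finset.sum_nbij' (fun j => l - j) (fun j => l - j) ?_ ?_ ?_ ?_ ?_
  · intro j hj; simp only [Finset.mem_Icc] at *; omega
  · intro j hj; simp only [Finset.mem_Icc] at *; omega
  · intro j hj; simp only [Finset.mem_Icc] at *; omega
  · intro j hj; simp only [Finset.mem_Icc] at *; omega
  · intro j hj
    simp only [Finset.mem_Icc] at *
    rw [show l - (l - j) = j by omega, show l - j + j = l by omega, mul_comm]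

/-! ### Quadratic forms in the weights and summation by parts. -/

theorem weight_neg_one (w : ℝ → ℝ) (c : ℝ) (n : ℕ) : weight w c n (-1) = 0 := by
  simp [weight]

theorem weight_zero (w : ℝ → ℝ) (c : ℝ) (n : ℕ) : weight w c n 0 = (n : ℝ)⁻¹ := by
  simp [weight]

theorem weight_of_pos (w : ℝ → ℝ) (c : ℝ) (n : ℕ) {k : ℤ} (hk : 0 < k) :
    weight w c n k = 2 * (n : ℝ)⁻¹ * w (k / c) := by
  simp [weight, hk.not_gt, hk.ne']

theorem sum_lower_triangle_split (f : ℕ → ℕ → ℝ) (n : ℕ) :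
    ∑ l ∈ Finset.Icc 1 n, ∑ j ∈ Finset.Icc 1 l, f l j
      = ∑ l ∈ Finset.Icc 1 n, f l l
        + ∑ l ∈ Finset.Icc 1 n, ∑ j ∈ Finset.Icc 1 (l - 1), f l j := by
  rw [← Finset.sum_add_distrib]
  refine Finset.sum_congr rfl fun l hl => ?_
  obtain ⟨m, rfl⟩ := Nat.exists_eq_add_of_le (Finset.mem_Icc.1 hl).1
  rw [add_comm 1 m, Finset.sum_Icc_succ_top (Nat.le_add_left 1 m), Nat.add_sub_cancel]
  ring

/-- The lag-window estimator is a quadratic form in the observations, up to `remR`. -/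
theorem estimator_eq (w : ℝ → ℝ) (c : ℝ) {n : ℕ} (hn : 1 ≤ n) (y : ℕ → ℝ) :
    estimator w c n y
      = ∑ l ∈ Finset.Icc 1 n, ∑ j ∈ Finset.Icc 1 l, weight w c n (l - j) * (y l * y j)
        + remR w c n y := by
  have hn0 : (n : ℝ) ≠ 0 := by positivity
  have hquad : ∑ l ∈ Finset.Icc 1 n, ∑ j ∈ Finset.Icc 1 l, weight w c n (l - j) * (y l * y j)
      = (n : ℝ)⁻¹ * ∑ l ∈ Finset.Icc 1 n, y l * y l
        + 2 * (n : ℝ)⁻¹ * ∑ k ∈ Finset.Icc 1 (n - 1),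
            w (k / c) * ∑ j ∈ Finset.Icc 1 (n - k), y j * y (j + k) := by
    rw [sum_lower_triangle_split (fun l j => weight w c n (l - j) * (y l * y j))]
    simp only [sub_self, weight_zero, ← Finset.mul_sum]
    congr 1
    simp only [Finset.mul_sum]
    rw [sum_lag_eq (fun k j => 2 * (n : ℝ)⁻¹ * (w (k / c) * (y j * y (j + k))))]
    refine Finset.sum_congr rfl fun l _ => Finset.sum_congr rfl fun j hj => ?_
    simp only [Finset.mem_Icc] at hj
    have hjl : j < l := by omega
    rw [weight_of_pos _ _ _ (by omega), Nat.add_sub_of_le hjl.le, Nat.cast_sub hjl.le]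
    push_cast
    ring
  have hcov : ∀ k ≤ n, sampleAutocov n k y
      = (n : ℝ)⁻¹ * ∑ j ∈ Finset.Icc 1 (n - k), y j * y (j + k)
        - (n : ℝ)⁻¹ * sampleMean n y * (∑ j ∈ Finset.Icc 1 (n - k), y j
          + ∑ j ∈ Finset.Icc 1 (n - k), y (j + k))
        + sampleMean n y ^ 2 * (1 - k / n) := by
    intro k hk
    have h1 : ∀ j, (y j - sampleMean n y) * (y (j + k) - sampleMean n y)
        = y j * y (j + k) - sampleMean n y * (y j + y (j + k)) + sampleMean n y ^ 2 :=
      fun j => by ring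
    simp only [sampleAutocov, h1, Finset.sum_add_distrib, Finset.sum_sub_distrib,
      ← Finset.mul_sum, Finset.sum_const, Nat.card_Icc, nsmul_eq_mul, Nat.add_sub_cancel,
      Nat.cast_sub hk]
    field_simp
  have hcov0 : sampleAutocov n 0 y = (n : ℝ)⁻¹ * ∑ l ∈ Finset.Icc 1 n, y l * y l
      - ((n : ℝ) ^ 2)⁻¹ * (∑ j ∈ Finset.Icc 1 n, y j) ^ 2 := by
    rw [hcov 0 (Nat.zero_le n), sampleMean]
    simp only [Nat.sub_zero, add_zero, Nat.cast_zero, zero_div]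
    field_simp
    ring
  have hsum : ∑ k ∈ Finset.Icc 1 (n - 1), w (k / c) * sampleAutocov n k y
      = (n : ℝ)⁻¹ * ∑ k ∈ Finset.Icc 1 (n - 1),
            w (k / c) * ∑ j ∈ Finset.Icc 1 (n - k), y j * y (j + k)
        - (n : ℝ)⁻¹ * sampleMean n y * (∑ k ∈ Finset.Icc 1 (n - 1),
            w (k / c) * ∑ j ∈ Finset.Icc 1 (n - k), y (j + k)
          + ∑ k ∈ Finset.Icc 1 (n - 1), w (k / c) * ∑ j ∈ Finset.Icc 1 (n - k), y j)
        + sampleMean n y ^ 2 * ∑ k ∈ Finset.Icc 1 (n - 1), w (k / c) * (1 - k / n) := by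
    simp only [Finset.mul_sum (s := Finset.Icc 1 (n - 1)), ← Finset.sum_add_distrib,
      ← Finset.sum_sub_distrib]
    refine Finset.sum_congr rfl fun k hk => ?_
    simp only [Finset.mem_Icc] at hk
    rw [hcov k (by omega)]
    ring
  rw [hquad, estimator, hcov0, hsum, remR, sum_mul_sum_upper y (fun k => w (k / c)) n,
    sum_mul_sum_lower y (fun k => w (k / c)), sampleMean]
  field_simp
  ring

/-- Summation by parts turns the quadratic form in `G - g` into the one in the increments. -/
theorem sum_quadratic_eq (a : ℤ → ℝ) (n : ℕ) (G g : ℕ → ℝ) :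
    ∑ l ∈ Finset.Icc 1 n, ∑ j ∈ Finset.Icc 1 l, a (l - j) * ((G l - g l) * (G j - g j))
      = ∑ l ∈ Finset.Icc 1 n, ∑ j ∈ Finset.Icc 1 l,
          a (l - j) * ((G l - g (l - 1)) * (G j - g (j - 1))) + remZeta a n G g := by
  induction n with
  | zero => simp [remZeta]
  | succ n ih =>
    have hN := Nat.le_add_left 1 n
    -- The boundary sum in `g n` is the one part of `remZeta` that changes with `n` otherwise than
    -- by gaining a term. The old sum is extended to `j = n + 1`, where the lag is `-1`, so that it
    -- can be compared with the new row.
    have e1 : ∑ j ∈ Finset.Icc 1 n, a (n - j) * (g n * g j - g n * G j)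
        = ∑ j ∈ Finset.Icc 1 (n + 1), a (n - j) * (g n * g j - g n * G j)
          - a (-1) * (g n * g (n + 1) - g n * G (n + 1)) := by
      rw [Finset.sum_Icc_succ_top hN]
      push_cast
      rw [show (n : ℤ) - (n + 1) = -1 by ring]
      ring
    -- The new row, minus its increment form and its share of the first three sums and of the
    -- boundary sum, is exactly the increment in `j` of this function.
    have t1 := sum_Icc_telescope
      (fun j => a (n - j) * (g n * g j) - a (n + 1 - j) * (G (n + 1) * g j)) (n + 1)
    have key : ∑ j ∈ Finset.Icc 1 (n + 1),
          a ((n + 1 : ℕ) - j) * ((G (n + 1) - g (n + 1)) * (G j - g j))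
        - ∑ j ∈ Finset.Icc 1 (n + 1),
          a ((n + 1 : ℕ) - j) * ((G (n + 1) - g (n + 1 - 1)) * (G j - g (j - 1)))
        - ∑ j ∈ Finset.Icc 1 (n + 1), (a ((n + 1 : ℕ) - j) - a ((n + 1 : ℕ) - 1 - j))
          * (g (n + 1 - 1) * G j - g (n + 1 - 1) * g (j - 1))
        - ∑ j ∈ Finset.Icc 1 (n + 1), (a ((n + 1 : ℕ) - j) - a ((n + 1 : ℕ) - (j - 1)))
          * (g (j - 1) * G (n + 1) - g (n + 1 - 1) * g (j - 1))
        - ∑ j ∈ Finset.Icc 1 (n + 1), (2 * a ((n + 1 : ℕ) - j) - a ((n + 1 : ℕ) - (j - 1))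
          - a ((n + 1 : ℕ) - 1 - j)) * (g (n + 1 - 1) * g (j - 1))
        - ∑ j ∈ Finset.Icc 1 (n + 1),
          a ((n + 1 : ℕ) - j) * (g (n + 1) * g j - g (n + 1) * G j)
        + ∑ j ∈ Finset.Icc 1 (n + 1), a (n - j) * (g n * g j - g n * G j)
        = ∑ j ∈ Finset.Icc 1 (n + 1),
          ((a (n - j) * (g n * g j) - a (n + 1 - j) * (G (n + 1) * g j))
            - (a (n - (j - 1 : ℕ)) * (g n * g (j - 1))
              - a (n + 1 - (j - 1 : ℕ)) * (G (n + 1) * g (j - 1)))) := by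
      simp only [← Finset.sum_sub_distrib, ← Finset.sum_add_distrib]
      refine Finset.sum_congr rfl fun j hj => ?_
      obtain ⟨i, rfl⟩ := Nat.exists_eq_add_of_le (Finset.mem_Icc.1 hj).1
      simp only [Nat.add_sub_cancel, Nat.add_sub_cancel_left]
      push_cast
      rw [show (n : ℤ) + 1 - 1 - (1 + i) = n - (1 + i) by ring,
        show (n : ℤ) + 1 - (1 + i - 1) = n + 1 - i by ring,
        show (n : ℤ) + 1 - (1 + i) = n - i by ring]
      ring
    rw [t1] at key
    push_cast at key
    rw [show (n : ℤ) - (n + 1) = -1 by ring, show (n : ℤ) + 1 - (n + 1) = 0 by ring,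
      sub_zero, sub_zero] at key
    rw [Finset.sum_Icc_succ_top hN
        (fun l => ∑ j ∈ Finset.Icc 1 l, a (l - j) * ((G l - g l) * (G j - g j))),
      Finset.sum_Icc_succ_top hN (fun l => ∑ j ∈ Finset.Icc 1 l,
        a (l - j) * ((G l - g (l - 1)) * (G j - g (j - 1)))), ih]
    unfold remZeta
    rw [Finset.sum_Icc_succ_top hN (fun l => ∑ j ∈ Finset.Icc 1 l,
        (a (l - j) - a (l - 1 - j)) * (g (l - 1) * G j - g (l - 1) * g (j - 1))),
      Finset.sum_Icc_succ_top hN (fun l => ∑ j ∈ Finset.Icc 1 l,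
        (a (l - j) - a (l - (j - 1))) * (g (j - 1) * G l - g (l - 1) * g (j - 1))),
      Finset.sum_Icc_succ_top hN (fun l => ∑ j ∈ Finset.Icc 1 l,
        (2 * a (l - j) - a (l - (j - 1)) - a (l - 1 - j)) * (g (l - 1) * g (j - 1))),
      Finset.sum_Icc_succ_top hN (fun l => (a l * (g 0 * G l) - a (l - 1) * (g 0 * g (l - 1)))),
      Finset.sum_Icc_succ_top hN (fun l => (a (-1) * (g (l - 1) * G l) - a 0 * (g l * G l))), e1]
    push_cast
    rw [show (n : ℤ) + 1 - 1 = n by ring] at key ⊢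
    linear_combination key

/-- The lag-window decomposition for sequences: quadratic form in the increments, `remR`,
and `remZeta`. -/
theorem estimator_decomposition (w : ℝ → ℝ) (c : ℝ) {n : ℕ} (hn : 1 ≤ n) (G g : ℕ → ℝ) :
    estimator w c n (fun j => G j - g j)
      = (n : ℝ)⁻¹ * ∑ l ∈ Finset.Icc 1 n, (G l - g (l - 1)) ^ 2
        + ∑ l ∈ Finset.Icc 1 n, ∑ j ∈ Finset.Icc 1 (l - 1),
          weight w c n (l - j) * (G l - g (l - 1)) * (G j - g (j - 1))
        + remR w c n (fun j => G j - g j) + remZeta (weight w c n) n G g := by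
  rw [estimator_eq w c hn, sum_quadratic_eq, sum_lower_triangle_split
    (fun l j => weight w c n (l - j) * ((G l - g (l - 1)) * (G j - g (j - 1))))]
  simp only [sub_self, weight_zero, ← Finset.mul_sum, ← pow_two, mul_assoc]
  ring

/-- The coefficients `a(k) - a(k-1)`, without their non-decaying parts at `k = 0, 1`. -/
def firstDiff (a : ℤ → ℝ) (ν : ℝ) (k : ℤ) : ℝ :=
  a k - a (k - 1) - ((if k = 0 then ν else 0) + if k = 1 then ν else 0)

/-- The coefficients `2a(k) - a(k+1) - a(k-1)`, without their non-decaying part at `k = 1`. -/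
def secondDiff (a : ℤ → ℝ) (ν : ℝ) (k : ℤ) : ℝ :=
  2 * a k - a (k + 1) - a (k - 1) - if k = 1 then ν else 0

theorem sum_Icc_ite_eq {l : ℕ} (hl : 1 ≤ l) (ν : ℝ) (x : ℕ → ℝ) :
    ∑ j ∈ Finset.Icc 1 l, (if (l : ℤ) - j = 0 then ν else 0) * x j = ν * x l := by
  rw [Finset.sum_eq_single l]
  · simp
  · intro j _ hjl
    rw [if_neg (by omega), zero_mul]
  · simp [hl]

theorem sum_Icc_ite_eq_one {l : ℕ} (ν : ℝ) (x : ℕ → ℝ) (hx : x 0 = 0) :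
    ∑ j ∈ Finset.Icc 1 l, (if (l : ℤ) - j = 1 then ν else 0) * x j = ν * x (l - 1) := by
  rw [Finset.sum_eq_single (l - 1)]
  · rcases Nat.eq_zero_or_pos (l - 1) with h | h
    · rw [h, hx]; simp
    · rw [if_pos (by omega)]
  · intro j hj hjl
    simp only [Finset.mem_Icc] at hj
    rw [if_neg (by omega), zero_mul]
  · intro h
    have : l - 1 = 0 := by simp only [Finset.mem_Icc] at h; omega
    rw [this, hx, mul_zero]

/-- Rearrangement of `remZeta`: the terms that do not decay cancel. -/
theorem remZeta_eq (a : ℤ → ℝ) (n : ℕ) (G g : ℕ → ℝ) (h1 : a (-1) = 0) (hn : 1 ≤ n) :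
    remZeta a n G g
      = a 0 * ∑ l ∈ Finset.Icc 1 n, g (l - 1) * (G l - g (l - 1))
        + ∑ l ∈ Finset.Icc 1 n, g (l - 1)
            * ∑ j ∈ Finset.Icc 1 l, firstDiff a (a 0) (l - j) * (G j - g (j - 1))
        + ∑ l ∈ Finset.Icc 1 n, (∑ j ∈ Finset.Icc 1 l,
            (a (l - j) - a (l - j + 1)) * g (j - 1)) * (G l - g (l - 1))
        + ∑ l ∈ Finset.Icc 1 n, g (l - 1)
            * ∑ j ∈ Finset.Icc 1 l, secondDiff a (a 0) (l - j) * g (j - 1)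
        + g 0 * (∑ l ∈ Finset.Icc 1 n, a l * (G l - g (l - 1))
            + ∑ l ∈ Finset.Icc 1 n, (a l - a (l - 1)) * g (l - 1))
        - g n * (∑ j ∈ Finset.Icc 1 n, a (n - j) * (G j - g (j - 1))
            + ∑ j ∈ Finset.Icc 1 n, (a (n - j) - a (n - j + 1)) * g (j - 1)
            + a n * g 0 - a 0 * g n)
        - a 0 * (g n * G n) := by
  have hx : ∀ l ∈ Finset.Icc 1 n,
      ∑ j ∈ Finset.Icc 1 l, (a (l - j) - a (l - 1 - j)) * (g (l - 1) * G j - g (l - 1) * g (j - 1))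
      + ∑ j ∈ Finset.Icc 1 l, (a (l - j) - a (l - (j - 1)))
          * (g (j - 1) * G l - g (l - 1) * g (j - 1))
      + ∑ j ∈ Finset.Icc 1 l, (2 * a (l - j) - a (l - (j - 1)) - a (l - 1 - j))
          * (g (l - 1) * g (j - 1))
      + (a (-1) * (g (l - 1) * G l) - a 0 * (g l * G l))
      = a 0 * (g (l - 1) * (G l - g (l - 1)))
        + g (l - 1) * ∑ j ∈ Finset.Icc 1 l, firstDiff a (a 0) (l - j) * (G j - g (j - 1))
        + (∑ j ∈ Finset.Icc 1 l, (a (l - j) - a (l - j + 1)) * g (j - 1)) * (G l - g (l - 1))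
        + g (l - 1) * ∑ j ∈ Finset.Icc 1 l, secondDiff a (a 0) (l - j) * g (j - 1)
        - a 0 * ((if l = 0 then 0 else g l * G l)
          - (if l - 1 = 0 then 0 else g (l - 1) * G (l - 1))) := by
    intro l hl
    have hl1 := (Finset.mem_Icc.1 hl).1
    have e0 := sum_Icc_ite_eq hl1 (a 0) fun j => g (l - 1) * (G j - g (j - 1))
    -- Row `l = 1` has no entry at lag `1`, as `j` starts at `1`. The value `0` at `j = 0` accounts
    -- for this and lets the products `g l * G l` telescope over rows.
    have e1 := sum_Icc_ite_eq_one (l := l) (a 0) (fun j => if j = 0 then 0 else g (l - 1) * G j)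
      (by simp)
    have e2 : (if l - 1 = 0 then 0 else g (l - 1) * G (l - 1))
        = (fun j => if j = 0 then 0 else g (l - 1) * G j) (l - 1) := rfl
    rw [h1, if_neg (by omega : l ≠ 0), e2, mul_sub (a 0), ← e1, ← e0]
    simp only [Finset.mul_sum, Finset.sum_mul]
    have hs : ∑ j ∈ Finset.Icc 1 l,
          (a (l - j) - a (l - 1 - j)) * (g (l - 1) * G j - g (l - 1) * g (j - 1))
        + ∑ j ∈ Finset.Icc 1 l, (a (l - j) - a (l - (j - 1)))
          * (g (j - 1) * G l - g (l - 1) * g (j - 1))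
        + ∑ j ∈ Finset.Icc 1 l, (2 * a (l - j) - a (l - (j - 1)) - a (l - 1 - j))
          * (g (l - 1) * g (j - 1))
        - ∑ j ∈ Finset.Icc 1 l, (if (l : ℤ) - j = 0 then a 0 else 0)
          * (g (l - 1) * (G j - g (j - 1)))
        - ∑ j ∈ Finset.Icc 1 l, g (l - 1) * (firstDiff a (a 0) (l - j) * (G j - g (j - 1)))
        - ∑ j ∈ Finset.Icc 1 l, (a (l - j) - a (l - j + 1)) * g (j - 1) * (G l - g (l - 1))
        - ∑ j ∈ Finset.Icc 1 l, g (l - 1) * (secondDiff a (a 0) (l - j) * g (j - 1))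
        - ∑ j ∈ Finset.Icc 1 l, (if (l : ℤ) - j = 1 then a 0 else 0)
          * (if j = 0 then 0 else g (l - 1) * G j) = 0 := by
      simp only [← Finset.sum_sub_distrib, ← Finset.sum_add_distrib]
      refine Finset.sum_eq_zero fun j hj => ?_
      have hj0 : j ≠ 0 := by have := (Finset.mem_Icc.1 hj).1; omega
      rw [if_neg hj0, firstDiff, secondDiff, show (l : ℤ) - 1 - j = l - j - 1 by ring,
        show (l : ℤ) - (j - 1) = l - j + 1 by ring]
      ring
    linear_combination hs
  have t0 := sum_Icc_telescope (fun l => if l = 0 then 0 else g l * G l) n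
  have hs := Finset.sum_congr rfl hx
  simp only [Finset.sum_add_distrib, Finset.sum_sub_distrib (s := Finset.Icc 1 n)] at hs
  rw [show ∑ l ∈ Finset.Icc 1 n, a 0 * ((if l = 0 then 0 else g l * G l)
      - (if l - 1 = 0 then 0 else g (l - 1) * G (l - 1))) = _ by rw [← Finset.mul_sum, t0]] at hs
  have h4 : ∑ l ∈ Finset.Icc 1 n, (a l * (g 0 * G l) - a (l - 1) * (g 0 * g (l - 1)))
      = g 0 * (∑ l ∈ Finset.Icc 1 n, a l * (G l - g (l - 1))
            + ∑ l ∈ Finset.Icc 1 n, (a l - a (l - 1)) * g (l - 1)) := by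
    rw [← Finset.sum_add_distrib, Finset.mul_sum]
    exact Finset.sum_congr rfl fun l _ => by ring
  -- Summation by parts in the boundary sum, which exposes the increments `G j - g (j - 1)`.
  have t5 := sum_Icc_telescope (fun j => a (n - j) * g j) n
  have h5 : ∑ j ∈ Finset.Icc 1 n, a (n - j) * (g n * g j - g n * G j)
      = - (g n * (∑ j ∈ Finset.Icc 1 n, a (n - j) * (G j - g (j - 1))
            + ∑ j ∈ Finset.Icc 1 n, (a (n - j) - a (n - j + 1)) * g (j - 1)
            + a n * g 0 - a 0 * g n)) := by
    have : a n * g 0 - a 0 * g n = - ∑ j ∈ Finset.Icc 1 n,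
        (a (n - j) * g j - a (n - j + 1) * g (j - 1)) := by
      rw [show a n * g 0 - a 0 * g n = -(a (n - n) * g n - a (n - (0 : ℕ)) * g 0) by simp, ← t5]
      congr 1
      refine Finset.sum_congr rfl fun j hj => ?_
      rw [Nat.cast_sub (Finset.mem_Icc.1 hj).1]
      congr 3
      push_cast
      ring
    rw [add_sub_assoc, this, ← Finset.sum_neg_distrib, ← Finset.sum_add_distrib,
      ← Finset.sum_add_distrib, Finset.mul_sum, ← Finset.sum_neg_distrib]
    exact Finset.sum_congr rfl fun l _ => by ring
  rw [remZeta, h4, h5, Finset.mul_sum (a := a 0) (s := Finset.Icc 1 n)]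
  simp only [if_neg (by omega : n ≠ 0), if_true, Finset.sum_sub_distrib] at hs ⊢
  linear_combination hs

end Algebra

/-! ### Regularity of the window and bounds on the weights -/

section Weights

variable {b : ℝ} {w : ℝ → ℝ}

theorem Window.differentiableOn (hw : Window b w) : DifferentiableOn ℝ w (Set.Ioo 0 b) :=
  hw.smooth.differentiableOn (by norm_num)

theorem Window.exists_lipschitz_deriv (hw : Window b w) : ∃ M : ℝ, 0 ≤ M ∧
    ∀ x ∈ Set.Ioo 0 b, ∀ y ∈ Set.Ioo 0 b, |deriv w y - deriv w x| ≤ M * |y - x| := by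
  obtain ⟨M, hM⟩ := hw.bounded
  refine ⟨|M|, abs_nonneg M, fun x hx y hy => ?_⟩
  have hd : DifferentiableOn ℝ (deriv w) (Set.Ioo 0 b) :=
    (hw.smooth.deriv_of_isOpen isOpen_Ioo (m := 1) (by norm_num)).differentiableOn (by norm_num)
  exact (convex_Ioo 0 b).norm_image_sub_le_of_norm_deriv_le
    (fun z hz => (hd z hz).differentiableAt (isOpen_Ioo.mem_nhds hz))
    (fun z hz => (hM z hz).trans (le_abs_self M)) hx hy

theorem Window.exists_deriv_eq (hw : Window b w) {x y : ℝ} (hx : 0 ≤ x) (hxy : x < y)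
    (hy : y ≤ b) : ∃ z ∈ Set.Ioo x y, w y - w x = deriv w z * (y - x) := by
  obtain ⟨z, hz, h⟩ := exists_deriv_eq_slope w hxy
    (hw.cont.mono fun t ht => hx.trans ht.1)
    (hw.differentiableOn.mono fun t ht => ⟨hx.trans_lt ht.1, ht.2.trans_le hy⟩)
  refine ⟨z, hz, ?_⟩
  rw [h, div_mul_cancel₀ _ (sub_pos.2 hxy).ne']

/-- The window stays at `w b = 0` beyond `b`, so estimates on `[0, b]` extend to the half-line
through the contraction `x ↦ min x b`. -/
theorem Window.eq_min (hw : Window b w) (x : ℝ) : w x = w (min x b) := by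
  rcases le_or_gt x b with h | h
  · rw [min_eq_left h]
  · rw [min_eq_right h.le, hw.supp x h, hw.right]

theorem Window.eq_zero (hw : Window b w) {x : ℝ} (h : b ≤ x) : w x = 0 := by
  rw [hw.eq_min, min_eq_right h, hw.right]

/-- A Lipschitz derivative on a bounded interval is bounded, by its value at the midpoint plus `M *
b`; continuity at the endpoints carries the mean value theorem to the closed interval. -/
theorem Window.exists_lipschitz (hw : Window b w) : ∃ L : ℝ, 0 ≤ L ∧
    ∀ x y, 0 ≤ x → 0 ≤ y → |w y - w x| ≤ L * |y - x| := by
  obtain ⟨M, hM0, hM⟩ := hw.exists_lipschitz_deriv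
  have hb := hw.pos
  have hmid : b / 2 ∈ Set.Ioo 0 b := ⟨by linarith, by linarith⟩
  set L := |deriv w (b / 2)| + M * b with hL
  have hL0 : 0 ≤ L := by positivity
  have hder : ∀ z ∈ Set.Ioo 0 b, |deriv w z| ≤ L := by
    intro z hz
    have h1 := hM _ hmid z hz
    have h2 : |z - b / 2| ≤ b := abs_le.2 ⟨by linarith [hz.1], by linarith [hz.2]⟩
    have h3 := abs_sub_abs_le_abs_sub (deriv w z) (deriv w (b / 2))
    nlinarith [mul_le_mul_of_nonneg_left h2 hM0]
  have key : ∀ x y, 0 ≤ x → x ≤ y → y ≤ b → |w y - w x| ≤ L * |y - x| := by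
    intro x y hx hxy hy
    rcases hxy.eq_or_lt with rfl | hxy
    · simp
    · obtain ⟨z, hz, h⟩ := hw.exists_deriv_eq hx hxy hy
      rw [h, abs_mul]
      exact mul_le_mul_of_nonneg_right
        (hder z ⟨hx.trans_lt hz.1, hz.2.trans_le hy⟩) (abs_nonneg _)
  have key2 : ∀ x y, 0 ≤ x → x ≤ y → |w y - w x| ≤ L * |y - x| := by
    intro x y hx hxy
    rw [hw.eq_min x, hw.eq_min y]
    refine (key _ _ (le_min hx hb.le) (min_le_min_right b hxy) (min_le_right _ _)).trans ?_
    refine mul_le_mul_of_nonneg_left ?_ hL0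
    simpa using abs_min_sub_min_le_max y b x b
  refine ⟨L, hL0, fun x y hx hy => ?_⟩
  rcases le_total x y with h | h
  · exact key2 x y hx h
  · rw [abs_sub_comm, abs_sub_comm y x]
    exact key2 y x hy h

/-- The mean value theorem on the two adjacent intervals gives a difference of derivatives at points
within `2 * δ`. The condition `x + 2 * δ ≤ b` avoids the possible kink at `b`. -/
theorem Window.exists_second_difference (hw : Window b w) : ∃ M : ℝ, 0 ≤ M ∧
    ∀ x δ, 0 ≤ x → 0 < δ → x + 2 * δ ≤ b →
      |2 * w (x + δ) - w (x + 2 * δ) - w x| ≤ M * δ ^ 2 := by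
  obtain ⟨M, hM0, hM⟩ := hw.exists_lipschitz_deriv
  refine ⟨2 * M, by positivity, fun x δ hx hδ h => ?_⟩
  obtain ⟨z, hz, h1⟩ := hw.exists_deriv_eq hx (by linarith : x < x + δ) (by linarith)
  obtain ⟨z', hz', h2⟩ := hw.exists_deriv_eq (by linarith : 0 ≤ x + δ)
    (by linarith : x + δ < x + 2 * δ) h
  have h3 : 2 * w (x + δ) - w (x + 2 * δ) - w x = (deriv w z - deriv w z') * δ := by
    linear_combination h1 - h2
  have h4 := hM z' ⟨by linarith [hz'.1], by linarith [hz'.2]⟩ z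
    ⟨by linarith [hz.1], by linarith [hz.2]⟩
  have h5 : |z - z'| ≤ 2 * δ :=
    abs_le.2 ⟨by linarith [hz.1, hz'.2], by linarith [hz.2, hz'.1]⟩
  rw [h3, abs_mul, abs_of_pos hδ]
  nlinarith [mul_le_mul_of_nonneg_left h5 hM0]

/-! ### Counting lags and summing differences of the weights. -/

theorem sum_Icc_ite_le {x : ℝ} (hx : 0 ≤ x) (m : ℕ) :
    ∑ k ∈ Finset.Icc 1 m, (if (k : ℝ) ≤ x then (1 : ℝ) else 0) ≤ x := by
  rw [← Finset.sum_filter, Finset.sum_const, nsmul_eq_mul, mul_one]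
  refine le_trans ?_ (Nat.floor_le hx)
  have : (Finset.Icc 1 m).filter (fun k : ℕ => (k : ℝ) ≤ x) ⊆ Finset.Icc 1 ⌊x⌋₊ := by
    intro k hk
    simp only [Finset.mem_filter, Finset.mem_Icc] at hk ⊢
    exact ⟨hk.1.1, Nat.le_floor hk.2⟩
  simpa using Finset.card_le_card this

theorem sum_Icc_ite_near_le {x : ℝ} (hx : 0 ≤ x) (m : ℕ) :
    ∑ k ∈ Finset.Icc 1 m, (if x < k + 1 ∧ (k : ℝ) < x + 1 then (1 : ℝ) else 0) ≤ 2 := by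
  rw [← Finset.sum_filter, Finset.sum_const, nsmul_eq_mul, mul_one]
  have : (Finset.Icc 1 m).filter (fun k : ℕ => x < k + 1 ∧ (k : ℝ) < x + 1)
      ⊆ Finset.Icc ⌊x⌋₊ (⌊x⌋₊ + 1) := by
    intro k hk
    simp only [Finset.mem_filter, Finset.mem_Icc] at hk ⊢
    have h1 := Nat.floor_le hx
    have h2 := Nat.lt_floor_add_one x
    have h3 : (⌊x⌋₊ : ℝ) < k + 1 := by linarith
    have h4 : (k : ℝ) < ⌊x⌋₊ + 1 + 1 := by linarith
    exact ⟨by exact_mod_cast Nat.lt_succ_iff.1 (by exact_mod_cast h3),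
      Nat.lt_succ_iff.1 (by exact_mod_cast h4)⟩
  have h := Finset.card_le_card this
  simp only [Nat.card_Icc] at h
  exact_mod_cast h.trans (by omega)

theorem Window.le_ite (hw : Window b w) {c : ℝ} (hc : 0 < c) (k : ℕ) :
    w (k / c) ≤ if (k : ℝ) ≤ b * c then (1 : ℝ) else 0 := by
  split_ifs with h
  · exact (hw.mem _ (by positivity)).2
  · rw [hw.eq_zero]
    rw [le_div_iff₀ hc]
    linarith

theorem Window.sum_le (hw : Window b w) {c : ℝ} (hc : 0 < c) (m : ℕ) :
    ∑ k ∈ Finset.Icc 1 m, w (k / c) ≤ b * c :=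
  (Finset.sum_le_sum fun k _ => hw.le_ite hc k).trans
    (sum_Icc_ite_le (mul_nonneg hw.pos.le hc.le) m)

/-- Summability and regularity of weights, at sample size `n` and bandwidth `c`. -/
structure WeightBounds (a : ℤ → ℝ) (n : ℕ) (c A : ℝ) : Prop where
  neg_one : a (-1) = 0
  zero : a 0 = (n : ℝ)⁻¹
  abs_le : ∀ k : ℕ, |a k| ≤ A / n
  sum_sq : ∀ m, ∑ k ∈ Finset.range m, a k ^ 2 ≤ A * (c / n ^ 2)
  sum_diff : ∀ m, ∑ k ∈ Finset.range m, |a k - a (k + 1)| ≤ A / n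
  sum_firstDiff : ∀ m, ∑ k ∈ Finset.range m, firstDiff a (a 0) k ^ 2 ≤ A * (1 / (n ^ 2 * c))
  sum_secondDiff : ∀ m, ∑ k ∈ Finset.range m, |secondDiff a (a 0) k| ≤ A * (1 / (n * c))

theorem sum_range_le_add_sum_Icc {f : ℕ → ℝ} (hf : ∀ k, 0 ≤ f k) (m : ℕ) :
    ∑ k ∈ Finset.range m, f k ≤ f 0 + ∑ k ∈ Finset.Icc 1 m, f k := by
  have : f 0 + ∑ k ∈ Finset.Icc 1 m, f k = ∑ k ∈ Finset.range (m + 1), f k := by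
    induction m with
    | zero => simp
    | succ m ih =>
      rw [Finset.sum_Icc_succ_top (Nat.le_add_left 1 m), ← add_assoc, ih,
        Finset.sum_range_succ _ (m + 1)]
  rw [this]
  exact Finset.sum_le_sum_of_subset_of_nonneg (Finset.range_mono (Nat.le_succ m))
    fun k _ _ => hf k

theorem weight_nat (w : ℝ → ℝ) (c : ℝ) (n : ℕ) {k : ℕ} (hk : k ≠ 0) :
    weight w c n k = 2 * (n : ℝ)⁻¹ * w (k / c) := by
  rw [weight_of_pos _ _ _ (by omega)]
  norm_num

/-- At lag `1` the subtracted `1/n` makes up for `a 0 = 1/n` being half of `(2/n) * w 0`, so the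
corrected difference is a genuine increment of the window. The same holds for `secondDiff` below. -/
theorem Window.firstDiff_weight (hw : Window b w) (c : ℝ) (n : ℕ) (k : ℕ) :
    firstDiff (weight w c n) (weight w c n 0) (k + 1 : ℕ)
      = 2 * (n : ℝ)⁻¹ * (w ((k + 1 : ℕ) / c) - w (k / c)) := by
  have h0 : ¬((k + 1 : ℕ) : ℤ) = 0 := by omega
  rw [firstDiff, if_neg h0, weight_nat w c n k.succ_ne_zero, weight_zero,
    show ((k + 1 : ℕ) : ℤ) - 1 = k by push_cast; ring]
  rcases Nat.eq_zero_or_pos k with rfl | hk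
  · simp only [zero_add, Nat.cast_one, if_true, Nat.cast_zero, weight_zero, zero_div, hw.zero]
    ring
  · rw [if_neg (by omega), weight_nat w c n hk.ne']
    ring

theorem Window.secondDiff_weight (hw : Window b w) (c : ℝ) (n : ℕ) (k : ℕ) :
    secondDiff (weight w c n) (weight w c n 0) (k + 1 : ℕ)
      = 2 * (n : ℝ)⁻¹ * (2 * w ((k + 1 : ℕ) / c) - w ((k + 2 : ℕ) / c) - w (k / c)) := by
  rw [secondDiff, weight_nat w c n k.succ_ne_zero, weight_zero,
    show ((k + 1 : ℕ) : ℤ) - 1 = k by push_cast; ring,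
    show ((k + 1 : ℕ) : ℤ) + 1 = (k + 2 : ℕ) by push_cast; ring,
    weight_nat w c n (k + 1).succ_ne_zero]
  rcases Nat.eq_zero_or_pos k with rfl | hk
  · simp only [zero_add, Nat.cast_one, if_true, Nat.cast_zero, weight_zero, zero_div, hw.zero]
    ring
  · rw [if_neg (by omega), weight_nat w c n hk.ne']
    ring

theorem Window.abs_sub_le (hw : Window b w) {L : ℝ}
    (hL : ∀ x y, 0 ≤ x → 0 ≤ y → |w y - w x| ≤ L * |y - x|) {c : ℝ} (hc : 0 < c) (k : ℕ) :
    |w ((k + 1 : ℕ) / c) - w (k / c)|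
      ≤ L / c * if ((k + 1 : ℕ) : ℝ) ≤ b * c + 1 then 1 else 0 := by
  split_ifs with h
  · refine (hL _ _ (by positivity) (by positivity)).trans ?_
    rw [← sub_div, show ((k + 1 : ℕ) : ℝ) - k = 1 by push_cast; ring, abs_of_pos (by positivity)]
    exact le_of_eq (by ring)
  · push_cast at h
    have h1 : b ≤ k / c := by rw [le_div_iff₀ hc]; linarith
    have h2 : b ≤ (k + 1 : ℕ) / c := by rw [le_div_iff₀ hc]; push_cast; linarith
    rw [hw.eq_zero h1, hw.eq_zero h2]
    simp

theorem Window.exists_weightBounds (hw : Window b w) {c₀ : ℝ} (hc₀ : 0 < c₀) :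
    ∃ A : ℝ, 0 ≤ A ∧ ∀ n : ℕ, 1 ≤ n → ∀ c, c₀ ≤ c → WeightBounds (weight w c n) n c A := by
  obtain ⟨L, hL0, hL⟩ := hw.exists_lipschitz
  obtain ⟨M, hM0, hM⟩ := hw.exists_second_difference
  have hb := hw.pos
  set B := b + 1 / c₀ with hB
  have hB0 : 0 < B := by positivity
  -- The five summands serve, in order, `abs_le`, `sum_sq`, `sum_diff`, `sum_firstDiff` and
  -- `sum_secondDiff`. The lower bound `c₀` on the bandwidth absorbs additive constants into
  -- multiples of `c`, as in `b * c + 1 ≤ B * c`.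
  refine ⟨2 + 4 * B + (1 + 2 * L * B) + 4 * L ^ 2 * B + (10 * L + 2 * M * b), by positivity,
    fun n hn c hcc => ?_⟩
  have hc : 0 < c := hc₀.trans_le hcc
  have hn0 : (0 : ℝ) < n := by positivity
  have hinv : 1 ≤ 1 / c₀ * c := by rw [one_div_mul_eq_div, one_le_div hc₀]; exact hcc
  have hBc : b * c + 1 ≤ B * c := by rw [hB]; linarith
  have hbc : 0 ≤ b * c := by positivity
  have hdiff := hw.abs_sub_le hL hc
  have hfirst0 : firstDiff (weight w c n) (weight w c n 0) 0 = 0 := by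
    simp [firstDiff, weight_neg_one]
  have hfirst : ∀ k : ℕ, |firstDiff (weight w c n) (weight w c n 0) k|
      ≤ 2 * L / (n * c) * if (k : ℝ) ≤ b * c + 1 then 1 else 0 := by
    intro k
    cases k with
    | zero =>
      rw [Nat.cast_zero, hfirst0, abs_zero]
      positivity
    | succ k =>
      rw [hw.firstDiff_weight, abs_mul, abs_of_pos (by positivity)]
      calc _ ≤ 2 * (n : ℝ)⁻¹ * (L / c * if ((k + 1 : ℕ) : ℝ) ≤ b * c + 1 then 1 else 0) :=
            mul_le_mul_of_nonneg_left (hdiff k) (by positivity)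
        _ = _ := by field_simp
  have hfsum : ∀ m, ∑ k ∈ Finset.range m, |firstDiff (weight w c n) (weight w c n 0) k|
      ≤ 2 * L * B / n := by
    intro m
    refine (sum_range_le_add_sum_Icc (fun k => abs_nonneg _) m).trans ?_
    rw [Nat.cast_zero, hfirst0, abs_zero, zero_add]
    refine (Finset.sum_le_sum fun k _ => hfirst k).trans ?_
    rw [← Finset.mul_sum]
    calc _ ≤ 2 * L / (n * c) * (B * c) := mul_le_mul_of_nonneg_left
          ((sum_Icc_ite_le (by positivity) m).trans hBc) (by positivity)
      _ = _ := by field_simp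
  have hmono : ∀ {s t u : ℝ}, s ≤ t → 0 ≤ u → s * u ≤ t * u := fun h hu =>
    mul_le_mul_of_nonneg_right h hu
  refine ⟨weight_neg_one _ _ _, weight_zero _ _ _, fun k => ?_, fun m => ?_, fun m => ?_,
    fun m => ?_, fun m => ?_⟩
  · have h2 : |weight w c n k| ≤ 2 / n := by
      rcases Nat.eq_zero_or_pos k with rfl | hk
      · rw [Nat.cast_zero, weight_zero, abs_of_pos (by positivity), inv_eq_one_div]
        gcongr
        norm_num
      · have := hw.mem (k / c) (by positivity)
        rw [weight_nat w c n hk.ne', abs_of_nonneg (mul_nonneg (by positivity) this.1),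
          div_eq_mul_inv]
        exact mul_le_of_le_one_right (by positivity) this.2
    refine h2.trans ?_
    gcongr
    have : 0 ≤ 4 * B + (1 + 2 * L * B) + 4 * L ^ 2 * B + (10 * L + 2 * M * b) := by positivity
    linarith
  · refine (sum_range_le_add_sum_Icc (fun k => sq_nonneg _) m).trans ?_
    have h1 : ∑ k ∈ Finset.Icc 1 m, weight w c n k ^ 2 ≤ 4 * ((n : ℝ)⁻¹) ^ 2 * (b * c) := by
      refine le_trans (Finset.sum_le_sum fun k hk => ?_)
        (le_trans (Finset.mul_sum _ _ _).ge (mul_le_mul_of_nonneg_left (hw.sum_le hc m)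
          (by positivity)))
      have := hw.mem (k / c) (by positivity)
      rw [weight_nat w c n (by have := (Finset.mem_Icc.1 hk).1; omega), mul_pow, mul_pow]
      norm_num
      gcongr
      nlinarith [this.1, this.2]
    have h2 : weight w c n (0 : ℕ) ^ 2 ≤ ((n : ℝ)⁻¹) ^ 2 * (1 / c₀ * c) := by
      rw [Nat.cast_zero, weight_zero]
      exact le_mul_of_one_le_right (by positivity) hinv
    have h3 : ((n : ℝ)⁻¹) ^ 2 * (1 / c₀ * c) + 4 * ((n : ℝ)⁻¹) ^ 2 * (b * c)
        = (1 / c₀ + 4 * b) * (c / n ^ 2) := by ring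
    refine (add_le_add h2 h1).trans (h3.le.trans (hmono ?_ (by positivity)))
    have : 0 ≤ 1 / c₀ := by positivity
    have : 0 ≤ (1 + 2 * L * B) + 4 * L ^ 2 * B + (10 * L + 2 * M * b) := by positivity
    linarith
  · have h1 : ∀ k : ℕ, |weight w c n k - weight w c n (k + 1)|
        ≤ |firstDiff (weight w c n) (weight w c n 0) (k + 1 : ℕ)|
          + if k = 0 then (n : ℝ)⁻¹ else 0 := by
      intro k
      have e : weight w c n k - weight w c n (k + 1)
          = -(firstDiff (weight w c n) (weight w c n 0) (k + 1 : ℕ)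
            + if k = 0 then (n : ℝ)⁻¹ else 0) := by
        have h0 : ¬(k : ℤ) + 1 = 0 := by omega
        simp only [firstDiff, weight_zero]
        push_cast
        rw [if_neg h0, add_sub_cancel_right]
        simp only [add_eq_right, Nat.cast_eq_zero]
        ring
      rw [e, abs_neg]
      refine (abs_add_le _ _).trans (add_le_add le_rfl (le_of_eq (abs_of_nonneg ?_)))
      positivity
    refine (Finset.sum_le_sum fun k _ => h1 k).trans ?_
    rw [Finset.sum_add_distrib]
    have h2 : ∑ k ∈ Finset.range m, |firstDiff (weight w c n) (weight w c n 0) (k + 1 : ℕ)|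
        ≤ 2 * L * B / n := by
      refine le_trans ?_ (hfsum (m + 1))
      rw [Finset.sum_range_succ' _ m]
      exact le_add_of_nonneg_right (abs_nonneg _)
    have h3 : ∑ k ∈ Finset.range m, (if k = 0 then (n : ℝ)⁻¹ else 0) ≤ 1 / n := by
      rw [Finset.sum_ite_eq', one_div]
      split_ifs
      · exact le_rfl
      · positivity
    refine (add_le_add h2 h3).trans ?_
    rw [← add_div]
    refine div_le_div_of_nonneg_right ?_ hn0.le
    have : 0 ≤ 2 + 4 * B + 4 * L ^ 2 * B + (10 * L + 2 * M * b) := by positivity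
    linarith
  · refine (sum_range_le_add_sum_Icc (fun k => sq_nonneg _) m).trans ?_
    rw [Nat.cast_zero, hfirst0]
    have h1 : ∀ k : ℕ, firstDiff (weight w c n) (weight w c n 0) k ^ 2
        ≤ (2 * L / (n * c)) ^ 2 * if (k : ℝ) ≤ b * c + 1 then 1 else 0 := by
      intro k
      have h2 := hfirst k
      rw [← sq_abs]
      refine (pow_le_pow_left₀ (abs_nonneg _) h2 2).trans (le_of_eq ?_)
      rw [mul_pow]
      split_ifs <;> norm_num
    have h2 := Finset.sum_le_sum fun k (_ : k ∈ Finset.Icc 1 m) => h1 k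
    rw [← Finset.mul_sum] at h2
    have h3 : (2 * L / (n * c)) ^ 2 * ∑ k ∈ Finset.Icc 1 m,
        (if (k : ℝ) ≤ b * c + 1 then (1 : ℝ) else 0) ≤ (2 * L / (n * c)) ^ 2 * (B * c) :=
      mul_le_mul_of_nonneg_left ((sum_Icc_ite_le (by positivity) m).trans hBc) (by positivity)
    have h4 : (2 * L / (n * c)) ^ 2 * (B * c) = 4 * L ^ 2 * B * (1 / (n ^ 2 * c)) := by
      field_simp
      ring
    have h5 : 4 * L ^ 2 * B * (1 / (n ^ 2 * c))
        ≤ (2 + 4 * B + (1 + 2 * L * B) + 4 * L ^ 2 * B + (10 * L + 2 * M * b))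
          * (1 / (n ^ 2 * c)) := by
      refine hmono ?_ (by positivity)
      have : 0 ≤ 2 + 4 * B + (1 + 2 * L * B) + (10 * L + 2 * M * b) := by positivity
      linarith
    linarith
  · refine (sum_range_le_add_sum_Icc (fun k => abs_nonneg _) m).trans ?_
    -- At lag `0` the second difference degenerates to a first one because `a (-1) = 0`; a single
    -- term of size `1 / (n * c)` is affordable.
    have h0 : |secondDiff (weight w c n) (weight w c n 0) (0 : ℕ)| ≤ 2 * L * (1 / (n * c)) := by
      have e : secondDiff (weight w c n) (weight w c n 0) (0 : ℕ)
          = -(2 * (n : ℝ)⁻¹ * (w ((0 + 1 : ℕ) / c) - w ((0 : ℕ) / c))) := by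
        have := weight_nat w c n one_ne_zero
        rw [Nat.cast_one] at this
        simp only [secondDiff, Nat.cast_zero, zero_add, zero_sub, weight_neg_one, weight_zero,
          this, zero_div, hw.zero]
        norm_num
        ring
      rw [e, abs_neg, abs_mul, abs_of_pos (by positivity)]
      have h1 : L / c * (if ((0 + 1 : ℕ) : ℝ) ≤ b * c + 1 then (1 : ℝ) else 0) ≤ L / c :=
        mul_le_of_le_one_right (by positivity) (by split_ifs <;> norm_num)
      calc _ ≤ 2 * (n : ℝ)⁻¹ * (L / c) :=
            mul_le_mul_of_nonneg_left ((hdiff 0).trans h1) (by positivity)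
        _ = _ := by field_simp
    have h1 : ∀ k ∈ Finset.Icc 1 m, |secondDiff (weight w c n) (weight w c n 0) k|
        ≤ 2 * M / (n * c ^ 2) * (if (k : ℝ) ≤ b * c then 1 else 0)
          + 4 * L / (n * c) * (if b * c < k + 1 ∧ (k : ℝ) < b * c + 1 then 1 else 0) := by
      intro k hk
      obtain ⟨i, rfl⟩ := Nat.exists_eq_add_of_le' (Finset.mem_Icc.1 hk).1
      rw [hw.secondDiff_weight, abs_mul, abs_of_pos (by positivity)]
      rcases le_or_gt ((i : ℝ) + 2) (b * c) with h | h
      -- Inside the support the second difference is `O(1 / c²)`, and about `b * c` lags contribute.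
      · rw [if_pos (by push_cast; linarith)]
        have e := hM (i / c) (1 / c) (by positivity) (by positivity)
          (by rw [mul_one_div, ← add_div, div_le_iff₀ hc]; exact h)
        rw [mul_one_div, ← add_div, ← add_div] at e
        push_cast
        calc _ ≤ 2 * (n : ℝ)⁻¹ * (M * (1 / c) ^ 2) :=
              mul_le_mul_of_nonneg_left e (by positivity)
          _ = 2 * M / (n * c ^ 2) * 1 := by field_simp
          _ ≤ _ := le_add_of_nonneg_right (by positivity)
      · rcases le_or_gt (b * c) i with h' | h'
        · have hz : ∀ j : ℕ, i ≤ j → w (j / c) = 0 := fun j hj => hw.eq_zero (by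
            rw [le_div_iff₀ hc]
            have : (i : ℝ) ≤ j := by exact_mod_cast hj
            linarith)
          rw [hz _ le_rfl, hz (i + 1) (by omega), hz (i + 2) (by omega)]
          simp only [mul_zero, sub_zero, abs_zero]
          positivity
        -- Straddling the kink at `b`, only the Lipschitz bound `O(1 / c)` is available, but this
        -- concerns at most two lags.
        · rw [if_pos (⟨by push_cast; linarith, by push_cast; linarith⟩ :
            b * c < ((i + 1 : ℕ) : ℝ) + 1 ∧ ((i + 1 : ℕ) : ℝ) < b * c + 1)]
          have hle : ∀ j : ℕ, |w ((j + 1 : ℕ) / c) - w (j / c)| ≤ L / c := fun j =>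
            (hdiff j).trans (mul_le_of_le_one_right (by positivity)
              (by split_ifs <;> norm_num))
          have e1 := hle i
          have e2 := hle (i + 1)
          have e3 : 2 * w ((i + 1 : ℕ) / c) - w ((i + 2 : ℕ) / c) - w (i / c)
              = (w ((i + 1 : ℕ) / c) - w (i / c))
                - (w ((i + 1 + 1 : ℕ) / c) - w ((i + 1 : ℕ) / c)) := by ring
          rw [e3]
          calc _ ≤ 2 * (n : ℝ)⁻¹ * (L / c + L / c) :=
                mul_le_mul_of_nonneg_left ((abs_sub _ _).trans (add_le_add e1 e2))
                  (by positivity)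
            _ = 4 * L / (n * c) * 1 := by field_simp; ring
            _ ≤ _ := le_add_of_nonneg_left (by positivity)
    have h2 := Finset.sum_le_sum h1
    rw [Finset.sum_add_distrib, ← Finset.mul_sum, ← Finset.mul_sum] at h2
    have h3 : 2 * M / (n * c ^ 2) * ∑ k ∈ Finset.Icc 1 m, (if (k : ℝ) ≤ b * c then (1 : ℝ) else 0)
        ≤ 2 * M / (n * c ^ 2) * (b * c) :=
      mul_le_mul_of_nonneg_left (sum_Icc_ite_le hbc m) (by positivity)
    have h4 : 4 * L / (n * c) * ∑ k ∈ Finset.Icc 1 m,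
        (if b * c < k + 1 ∧ (k : ℝ) < b * c + 1 then (1 : ℝ) else 0) ≤ 4 * L / (n * c) * 2 :=
      mul_le_mul_of_nonneg_left (sum_Icc_ite_near_le hbc m) (by positivity)
    have h5 : 2 * L * (1 / (n * c)) + (2 * M / (n * c ^ 2) * (b * c) + 4 * L / (n * c) * 2)
        = (10 * L + 2 * M * b) * (1 / (n * c)) := by
      field_simp
      ring
    refine (add_le_add h0 (h2.trans (add_le_add h3 h4))).trans (h5.le.trans (hmono ?_
      (by positivity)))
    have : 0 ≤ 2 + 4 * B + (1 + 2 * L * B) + 4 * L ^ 2 * B := by positivity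
    linarith

end Weights

/-! ### The Poisson equation -/

section Poisson

variable {S : Type*} [MeasurableSpace S]

/-- The Jordan decomposition of `α - β`, written without subtraction, so that integrals can be
compared through nonnegative measures alone. -/
theorem add_negPart_eq_add_posPart (α β : Measure S) [IsFiniteMeasure α] [IsFiniteMeasure β] :
    α + (α.toSignedMeasure - β.toSignedMeasure).toJordanDecomposition.negPart
      = β + (α.toSignedMeasure - β.toSignedMeasure).toJordanDecomposition.posPart := by
  have h := SignedMeasure.toSignedMeasure_toJordanDecomposition
    (α.toSignedMeasure - β.toSignedMeasure)
  rw [JordanDecomposition.toSignedMeasure] at h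
  rw [← Measure.toSignedMeasure_eq_toSignedMeasure_iff, Measure.toSignedMeasure_add,
    Measure.toSignedMeasure_add, ← sub_eq_zero]
  rw [← sub_eq_zero] at h
  rw [← neg_eq_zero, ← h]
  abel

variable {V f : S → ℝ} {α β : Measure S} [IsFiniteMeasure α] [IsFiniteMeasure β]

theorem wNorm_eq (V : S → ℝ) (ν : SignedMeasure S) :
    wNorm V ν = ∫⁻ x, ENNReal.ofReal (V x) ∂ν.toJordanDecomposition.posPart
      + ∫⁻ x, ENNReal.ofReal (V x) ∂ν.toJordanDecomposition.negPart :=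
  lintegral_add_measure _ _ _

/-- Used to carry integrability of `V` from the Dirac mass `P ^ 0` to `μ`, and from `μ` to every `P
^ j`. -/
theorem lintegral_lt_top_iff_of_wNorm
    (h : wNorm V (α.toSignedMeasure - β.toSignedMeasure) < ∞) :
    ∫⁻ x, ENNReal.ofReal (V x) ∂α < ∞ ↔ ∫⁻ x, ENNReal.ofReal (V x) ∂β < ∞ := by
  rw [wNorm_eq, ENNReal.add_lt_top] at h
  have e := congrArg (fun m => ∫⁻ x, ENNReal.ofReal (V x) ∂m) (add_negPart_eq_add_posPart α β)
  simp only [lintegral_add_measure] at e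
  constructor
  · intro hα
    exact (le_self_add.trans e.ge).trans_lt (ENNReal.add_lt_top.2 ⟨hα, h.2⟩)
  · intro hβ
    exact (le_self_add.trans e.le).trans_lt (ENNReal.add_lt_top.2 ⟨hβ, h.1⟩)

theorem integrable_of_abs_le {H : ℝ} {m : Measure S} (hf : Measurable f) (hV : ∀ x, 0 ≤ V x)
    (hfV : ∀ x, |f x| ≤ H * V x) (hm : ∫⁻ x, ENNReal.ofReal (V x) ∂m < ∞) (hVm : Measurable V) :
    Integrable f m := by
  have hI : Integrable V m := by
    refine ⟨hVm.aestronglyMeasurable, ?_⟩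
    rwa [hasFiniteIntegral_iff_ofReal (ae_of_all _ hV)]
  exact (hI.const_mul H).mono' hf.aestronglyMeasurable (ae_of_all _ hfV)

theorem abs_integral_sub_le_wNorm {H : ℝ} (hf : Measurable f) (hVm : Measurable V)
    (hV : ∀ x, 0 ≤ V x) (hfV : ∀ x, |f x| ≤ H * V x)
    (h : wNorm V (α.toSignedMeasure - β.toSignedMeasure) < ∞)
    (hα : ∫⁻ x, ENNReal.ofReal (V x) ∂α < ∞) :
    |∫ x, f x ∂α - ∫ x, f x ∂β|
      ≤ H * (wNorm V (α.toSignedMeasure - β.toSignedMeasure)).toReal := by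
  have hβ := (lintegral_lt_top_iff_of_wNorm h).1 hα
  have e := congrArg (fun m => ∫ x, f x ∂m) (add_negPart_eq_add_posPart α β)
  rw [wNorm_eq] at h ⊢
  set ν := α.toSignedMeasure - β.toSignedMeasure
  obtain ⟨hp, hn⟩ := ENNReal.add_lt_top.1 h
  have hI : ∀ {m : Measure S}, ∫⁻ x, ENNReal.ofReal (V x) ∂m < ∞ → Integrable f m :=
    fun hm => integrable_of_abs_le hf hV hfV hm hVm
  have hb : ∀ {m : Measure S}, ∫⁻ x, ENNReal.ofReal (V x) ∂m < ∞ →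
      |∫ x, f x ∂m| ≤ H * (∫⁻ x, ENNReal.ofReal (V x) ∂m).toReal := by
    intro m hm
    have hVI : Integrable V m :=
      integrable_of_abs_le (H := 1) hVm hV (fun x => by rw [abs_of_nonneg (hV x), one_mul]) hm hVm
    rw [← integral_eq_lintegral_of_nonneg_ae (ae_of_all _ hV) hVm.aestronglyMeasurable,
      ← integral_const_mul]
    exact (abs_integral_le_integral_abs).trans
      (integral_mono (hI hm).abs (hVI.const_mul H) hfV)
  simp only [integral_add_measure (hI hα) (hI hn), integral_add_measure (hI hβ) (hI hp)] at e
  have e' : ∫ x, f x ∂α - ∫ x, f x ∂β = ∫ x, f x ∂ν.toJordanDecomposition.posPart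
      - ∫ x, f x ∂ν.toJordanDecomposition.negPart := by linarith
  rw [e', ENNReal.toReal_add hp.ne hn.ne, mul_add]
  exact (abs_sub _ _).trans (add_le_add (hb hp) (hb hn))

variable {P : Kernel S S} [IsMarkovKernel P] {μ : Measure S} [IsProbabilityMeasure μ]
  {V₁ V₂ : S → ℝ} {h : S → ℝ} {H : ℝ}

/-- The quantitative content of short-range dependence used for the Poisson equation. -/
theorem ShortRange.exists_bound (hs : ShortRange P μ V₁ V₂) (hm₁ : Measurable V₁)
    (hV₁ : ∀ x, 0 ≤ V₁ x) (hV₂ : ∀ x, 0 ≤ V₂ x) :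
    ∃ C : ℝ, 0 ≤ C ∧ ∀ (h : S → ℝ) (H : ℝ), Measurable h → 0 ≤ H → (∀ x, |h x| ≤ H * V₁ x) →
      ∫ x, h x ∂μ = 0 → ∀ x, (∀ j, Integrable h ((P ^ j) x)) ∧
        Summable (fun j => |∫ z, h z ∂((P ^ j) x)|) ∧
        ∑' j, |∫ z, h z ∂((P ^ j) x)| ≤ H * C * V₂ x := by
  obtain ⟨C, hC⟩ := hs
  refine ⟨C, C.2, fun h H hm hH hb hμ x => ?_⟩
  set v : ℕ → ℝ≥0∞ := fun j => wNorm V₁ (((P ^ j) x).toSignedMeasure - μ.toSignedMeasure) with hv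
  have hfin : ∑' j, v j ≠ ∞ :=
    ((hC x).trans_lt (ENNReal.mul_lt_top ENNReal.coe_lt_top ENNReal.ofReal_lt_top)).ne
  have hvj : ∀ j, v j < ∞ := fun j => (ENNReal.ne_top_of_tsum_ne_top hfin j).lt_top
  -- The term `ℓ = 0` of the short-range sum compares the Dirac mass at `x` with `μ`, and hence
  -- shows that `μ` integrates `V₁`.
  have h0 : ∫⁻ z, ENNReal.ofReal (V₁ z) ∂((P ^ 0) x) < ∞ := by
    change ∫⁻ z, ENNReal.ofReal (V₁ z) ∂(Measure.dirac x) < ∞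
    rw [lintegral_dirac' _ hm₁.ennreal_ofReal]
    exact ENNReal.ofReal_lt_top
  have hμV := (lintegral_lt_top_iff_of_wNorm (hvj 0)).1 h0
  have hjV : ∀ j, ∫⁻ z, ENNReal.ofReal (V₁ z) ∂((P ^ j) x) < ∞ := fun j =>
    (lintegral_lt_top_iff_of_wNorm (hvj j)).2 hμV
  have hle : ∀ j, |∫ z, h z ∂((P ^ j) x)| ≤ H * (v j).toReal := by
    intro j
    have := abs_integral_sub_le_wNorm hm hm₁ hV₁ hb (hvj j) (hjV j)
    rwa [hμ, sub_zero] at this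
  have hsum : Summable fun j => H * (v j).toReal := (ENNReal.summable_toReal hfin).mul_left H
  refine ⟨fun j => integrable_of_abs_le hm hV₁ hb (hjV j) hm₁,
    Summable.of_nonneg_of_le (fun _ => abs_nonneg _) hle hsum, ?_⟩
  refine (Summable.tsum_le_tsum hle (Summable.of_nonneg_of_le (fun _ => abs_nonneg _) hle hsum)
    hsum).trans ?_
  rw [tsum_mul_left, ← ENNReal.tsum_toReal_eq fun j => (hvj j).ne, mul_assoc]
  refine mul_le_mul_of_nonneg_left ?_ hH
  refine (ENNReal.toReal_mono (ENNReal.mul_ne_top ENNReal.coe_ne_top ENNReal.ofReal_ne_top)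
    (hC x)).trans (le_of_eq ?_)
  rw [ENNReal.toReal_mul, ENNReal.toReal_ofReal (hV₂ x), ENNReal.coe_toReal]

theorem measurable_integral_pow (P : Kernel S S) [IsMarkovKernel P] (hm : Measurable h) (j : ℕ) :
    Measurable fun x => ∫ z, h z ∂((P ^ j) x) :=
  (StronglyMeasurable.integral_kernel hm.stronglyMeasurable).measurable

theorem measurable_poissonSol (P : Kernel S S) [IsMarkovKernel P] (hm : Measurable h) :
    Measurable (poissonSol P h) :=
  Measurable.tsum fun j => measurable_integral_pow P hm j

theorem measurable_poissonSolNext (P : Kernel S S) [IsMarkovKernel P] (hm : Measurable h) :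
    Measurable (poissonSolNext P h) :=
  (StronglyMeasurable.integral_kernel (measurable_poissonSol P hm).stronglyMeasurable).measurable

theorem abs_tsum_le_of_summable {s : ℕ → ℝ} (hs : Summable fun j => |s j|) :
    |∑' j, s j| ≤ ∑' j, |s j| :=
  norm_tsum_le_tsum_norm (f := s) hs

theorem integral_integral_pow {P : Kernel S S} {x : S} {j : ℕ} (hi : Integrable h ((P ^ (j + 1)) x)) :
    ∫ z, ∫ y, h y ∂((P ^ j) z) ∂(P x) = ∫ y, h y ∂((P ^ (j + 1)) x) := by
  have e : P ^ (j + 1) = (P ^ j) ∘ₖ P := pow_succ P j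
  rw [e] at hi ⊢
  exact (Kernel.integral_comp hi).symm

/-- Applying `P` term by term shifts the series by one. The interchange is justified by an envelope
`B` of the absolute series with `PB(x)` finite; the missing term `j = 0` is `h x`. -/
theorem poissonSol_eq_add {B : S → ℝ} (hm : Measurable h)
    (hs : ∀ x, Summable (fun j => |∫ z, h z ∂((P ^ j) x)|))
    (hB : ∀ x, ∑' j, |∫ z, h z ∂((P ^ j) x)| ≤ B x)
    (hi : ∀ x j, Integrable h ((P ^ j) x))
    (x : S) (hBx : ∫⁻ z, ENNReal.ofReal (B z) ∂(P x) < ∞) :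
    poissonSolNext P h x = ∑' j, ∫ z, h z ∂((P ^ (j + 1)) x) ∧
      poissonSol P h x = h x + poissonSolNext P h x := by
  have h1 : poissonSolNext P h x = ∑' j, ∫ z, h z ∂((P ^ (j + 1)) x) := by
    unfold poissonSolNext poissonSol
    rw [integral_tsum]
    · exact tsum_congr fun j => integral_integral_pow (hi x (j + 1))
    · exact fun j => (measurable_integral_pow P hm j).aestronglyMeasurable
    · rw [← lintegral_tsum fun j => (measurable_integral_pow P hm j).enorm.aemeasurable]
      refine ((lintegral_mono fun z => ?_).trans_lt hBx).ne
      simp only [Real.enorm_eq_ofReal_abs]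
      rw [← ENNReal.ofReal_tsum_of_nonneg (fun j => abs_nonneg _) (hs z)]
      exact ENNReal.ofReal_le_ofReal (hB z)
  refine ⟨h1, ?_⟩
  rw [h1, poissonSol, (hs x).of_abs.tsum_eq_zero_add]
  congr 1
  change ∫ z, h z ∂(Measure.dirac x) = h x
  exact integral_dirac' h x hm.stronglyMeasurable

end Poisson

/-! ### The Markov property for integrable functions -/

section Markov

variable {S Ω : Type*} [MeasurableSpace S] [mΩ : MeasurableSpace Ω] {Pr : Measure Ω}
  [IsProbabilityMeasure Pr] {P : Kernel S S} [IsMarkovKernel P] {X : ℕ → Ω → S}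

theorem measurable_history (hX : ∀ n, Measurable (X n)) {i n : ℕ} (hin : i ≤ n) :
    Measurable[history X hX n] (X i) := by
  rw [measurable_iff_comap_le]
  exact le_iSup₂_of_le (f := fun i (_ : i ≤ n) => MeasurableSpace.comap (X i) _) i hin le_rfl

/-- As an identity of measures, the Markov property for indicators extends to integrable functions
by the composition formula for integrals, without approximation. -/
theorem IsMarkovChain.map_restrict_succ (hX : IsMarkovChain P Pr X) (n : ℕ) {B : Set Ω}
    (hB : MeasurableSet[history X hX.measurable n] B) :
    (Pr.restrict B).map (X (n + 1)) = ((Pr.restrict B).map (X n)).bind P := by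
  have hBm : MeasurableSet B := (history X hX.measurable).le n _ hB
  ext A hA
  have hXA : MeasurableSet (X (n + 1) ⁻¹' A) := hX.measurable _ hA
  rw [Measure.map_apply (hX.measurable _) hA, Measure.bind_apply hA P.measurable.aemeasurable,
    lintegral_map (P.measurable_coe hA) (hX.measurable n), Measure.restrict_apply hXA]
  have hm := hX.markov n A hA
  have hi : Integrable ((X (n + 1) ⁻¹' A).indicator fun _ => (1 : ℝ)) Pr :=
    (integrable_const 1).indicator hXA
  have h1 := setIntegral_condExp ((history X hX.measurable).le n) hi hB
  rw [setIntegral_congr_ae hBm (hm.mono fun ω hω _ => hω), integral_indicator hXA,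
    setIntegral_const, smul_eq_mul, mul_one, Measure.real, Measure.restrict_apply hXA] at h1
  have h2 : Measurable fun ω => (P (X n ω)).real A :=
    ((P.measurable_coe hA).comp (hX.measurable n)).ennreal_toReal
  rw [integral_eq_lintegral_of_nonneg_ae (ae_of_all _ fun _ => measureReal_nonneg)
    h2.aestronglyMeasurable] at h1
  have h3 : ∀ ω, ENNReal.ofReal ((P (X n ω)).real A) = P (X n ω) A := fun ω =>
    ENNReal.ofReal_toReal (measure_ne_top _ _)
  simp only [h3] at h1
  refine ((ENNReal.toReal_eq_toReal_iff' ?_ (measure_ne_top _ _)).1 h1).symm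
  refine ((lintegral_mono fun ω => prob_le_one).trans_lt ?_).ne
  simp

theorem IsMarkovChain.setIntegral_succ (hX : IsMarkovChain P Pr X) (n : ℕ) {f : S → ℝ}
    (hf : Measurable f) (hi : Integrable (fun ω => f (X (n + 1) ω)) Pr) {B : Set Ω}
    (hB : MeasurableSet[history X hX.measurable n] B) :
    IntegrableOn (fun ω => ∫ z, f z ∂(P (X n ω))) B Pr ∧
      ∫ ω in B, f (X (n + 1) ω) ∂Pr = ∫ ω in B, ∫ z, f z ∂(P (X n ω)) ∂Pr := by
  have hmap := hX.map_restrict_succ n hB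
  have h1 : Integrable f ((Pr.restrict B).map (X (n + 1))) :=
    (integrable_map_measure hf.aestronglyMeasurable (hX.measurable _).aemeasurable).2
      hi.integrableOn
  rw [← integral_map (hX.measurable _).aemeasurable hf.aestronglyMeasurable]
  rw [hmap, Measure.comp_eq_comp_const_apply] at h1
  rw [hmap, Measure.comp_eq_comp_const_apply, Kernel.integral_comp h1, Kernel.const_apply]
  have hsm : StronglyMeasurable fun x => ∫ z, f z ∂(P x) :=
    StronglyMeasurable.integral_kernel hf.stronglyMeasurable
  refine ⟨?_, integral_map (hX.measurable n).aemeasurable hsm.aestronglyMeasurable⟩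
  have h2 := h1.integral_comp
  rw [Kernel.const_apply] at h2
  exact (integrable_map_measure hsm.aestronglyMeasurable (hX.measurable n).aemeasurable).1 h2

theorem IsMarkovChain.condExp_succ (hX : IsMarkovChain P Pr X) (n : ℕ) {f : S → ℝ}
    (hf : Measurable f) (hi : Integrable (fun ω => f (X (n + 1) ω)) Pr) :
    (fun ω => ∫ z, f z ∂(P (X n ω))) =ᵐ[Pr]
      Pr[fun ω => f (X (n + 1) ω) | history X hX.measurable n] := by
  have hsm : StronglyMeasurable fun x => ∫ z, f z ∂(P x) :=
    StronglyMeasurable.integral_kernel hf.stronglyMeasurable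
  refine ae_eq_condExp_of_forall_setIntegral_eq ((history X hX.measurable).le n) hi
    (fun s hs _ => (hX.setIntegral_succ n hf hi hs).1)
    (fun s hs _ => (hX.setIntegral_succ n hf hi hs).2.symm) ?_
  exact (hsm.measurable.comp (measurable_history hX.measurable le_rfl)).stronglyMeasurable
    |>.aestronglyMeasurable

/-- The increments of the Poisson solution along the chain are martingale differences. -/
theorem IsMarkovChain.isMartingaleDifference_incr (hX : IsMarkovChain P Pr X) {h : S → ℝ}
    (hm : Measurable h) (hi : ∀ n, Integrable (fun ω => poissonSol P h (X n ω)) Pr) :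
    IsMartingaleDifference (history X hX.measurable) Pr (incr P h X) where
  -- At `j = 0` truncated subtraction makes the increment `G(X_0) - PG(X_0)`: still adapted, and
  -- orthogonality is required only from index `1` on.
  adapted j :=
    (((measurable_poissonSol P hm).comp (measurable_history hX.measurable le_rfl)).sub
      ((measurable_poissonSolNext P hm).comp
        (measurable_history hX.measurable j.pred_le))).stronglyMeasurable
  orthogonal j Z hZ hZi := by
    have hc := hX.condExp_succ j (measurable_poissonSol P hm) (hi (j + 1))
    have hle := (history X hX.measurable).le j
    have hP : StronglyMeasurable[history X hX.measurable j]
        fun ω => poissonSolNext P h (X j ω) :=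
      ((measurable_poissonSolNext P hm).comp
        (measurable_history hX.measurable le_rfl)).stronglyMeasurable
    have hPi : Integrable (fun ω => poissonSolNext P h (X j ω)) Pr :=
      integrable_condExp.congr hc.symm
    have h0 : Pr[incr P h X (j + 1) | history X hX.measurable j] =ᵐ[Pr] 0 := by
      have e : incr P h X (j + 1) = (fun ω => poissonSol P h (X (j + 1) ω))
        - fun ω => poissonSolNext P h (X j ω) := rfl
      rw [e]
      filter_upwards [condExp_sub (hi (j + 1)) hPi (history X hX.measurable j), hc] with ω h1 h2
      rw [h1, Pi.sub_apply, condExp_of_stronglyMeasurable hle hP hPi, ← h2]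
      simp [poissonSolNext]
    have h1 := condExp_mul_of_stronglyMeasurable_left hZ hZi ((hi (j + 1)).sub hPi)
    have h2 := integral_condExp (μ := Pr) hle (f := fun ω => Z ω * incr P h X (j + 1) ω)
    rw [← h2]
    refine integral_eq_zero_of_ae ?_
    filter_upwards [h1, h0] with ω h3 h4
    refine h3.trans ?_
    simp only [Pi.mul_apply, Pi.zero_apply] at h4 ⊢
    exact mul_eq_zero_of_right _ h4

end Markov

/-! ### Moment bounds for the terms of the decomposition -/

section Bounds

variable {Ω : Type*} [mΩ : MeasurableSpace Ω] {Pr : Measure Ω} {F : Filtration ℕ mΩ}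
  {p K : ℝ} {G g : ℕ → Ω → ℝ}

/-- A martingale approximation `G l - g (l - 1)`, with moments of order `2p` bounded by `K`. -/
structure MartingaleApprox (F : Filtration ℕ mΩ) (Pr : Measure Ω) (p K : ℝ)
    (G g : ℕ → Ω → ℝ) : Prop where
  one_lt : 1 < p
  le : p ≤ 3 / 2
  diff : IsMartingaleDifference F Pr fun l ω => G l ω - g (l - 1) ω
  meas : ∀ l, StronglyMeasurable[F l] (g l)
  bound : ∀ l, LpBound Pr (2 * p) (G l) K
  bound_next : ∀ l, LpBound Pr (2 * p) (g l) K

namespace MartingaleApprox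

variable {n : ℕ} {c A : ℝ} {a : ℤ → ℝ}

theorem nonneg (M : MartingaleApprox F Pr p K G g) : 0 ≤ K := (M.bound 0).nonneg

theorem one_le_two_mul (M : MartingaleApprox F Pr p K G g) : 1 ≤ 2 * p := by
  linarith [M.one_lt]

theorem lpBound_incr (M : MartingaleApprox F Pr p K G g) (l : ℕ) :
    LpBound Pr (2 * p) (fun ω => G l ω - g (l - 1) ω) (2 * K) :=
  ((M.bound l).sub M.one_le_two_mul (M.bound_next (l - 1))).mono (by linarith)

/-- Deterministic combinations of increments cost the `ℓ²` norm of the coefficients; the `8` is `4`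
from the martingale inequality times `2` from the increment bound. -/
theorem lpBound_sum_mul (M : MartingaleApprox F Pr p K G g) (α : ℕ → ℝ) (m : ℕ) {s : ℝ}
    (hs : ∑ j ∈ Finset.Icc 1 m, α j ^ 2 ≤ s) :
    LpBound Pr (2 * p) (fun ω => ∑ j ∈ Finset.Icc 1 m, α j * (G j ω - g (j - 1) ω))
      (8 * K * √s) := by
  refine ((M.diff.const_mul α).lpBound_sum_of_two_lt (by linarith [M.one_lt])
    (by linarith [M.le]) m fun j _ => (M.lpBound_incr j).const_mul (α j)).mono ?_
  have h : ∑ j ∈ Finset.Icc 1 m, (|α j| * (2 * K)) ^ 2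
      = (2 * K) ^ 2 * ∑ j ∈ Finset.Icc 1 m, α j ^ 2 := by
    rw [Finset.mul_sum]
    refine Finset.sum_congr rfl fun j _ => ?_
    rw [mul_pow, sq_abs, mul_comm]
  have hK := M.nonneg
  rw [h, Real.sqrt_mul (by positivity), Real.sqrt_sq (by positivity)]
  have := Real.sqrt_le_sqrt hs
  nlinarith [mul_le_mul_of_nonneg_left this hK]

/-- With random predictable coefficients the summands lie only in `L^p`, so von Bahr–Esseen applies
and the cost is `n ^ (1 / p)`. -/
theorem lpBound_predictable_sum (M : MartingaleApprox F Pr p K G g) {Y : ℕ → Ω → ℝ} {L : ℝ}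
    (hL : 0 ≤ L) (h0 : StronglyMeasurable[F 0] (Y 0))
    (hY : ∀ j, StronglyMeasurable[F j] (Y (j + 1)))
    (hb : ∀ l ∈ Finset.Icc 1 n, LpBound Pr (2 * p) (Y l) L) :
    LpBound Pr p (fun ω => ∑ l ∈ Finset.Icc 1 n, Y l ω * (G l ω - g (l - 1) ω))
      (8 * K * L * (n : ℝ) ^ (1 / p)) := by
  refine ((M.diff.predictable_mul h0 hY).lpBound_sum_of_le_two M.one_lt (by linarith [M.le]) n
    (mul_nonneg hL (mul_nonneg two_pos.le M.nonneg))
    fun l hl => (hb l hl).mul M.one_lt.le (M.lpBound_incr l)).mono (le_of_eq (by ring))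

theorem sum_Icc_sq_le (hW : WeightBounds a n c A) (l : ℕ) :
    ∑ j ∈ Finset.Icc 1 (l - 1), a (l - j) ^ 2 ≤ A * (c / n ^ 2) := by
  have h1 : ∑ j ∈ Finset.Icc 1 (l - 1), a (l - j) ^ 2 ≤ ∑ j ∈ Finset.Icc 1 l, a (l - j) ^ 2 :=
    Finset.sum_le_sum_of_subset_of_nonneg (Finset.Icc_subset_Icc_right (Nat.sub_le l 1))
      fun _ _ _ => sq_nonneg _
  rw [sum_Icc_lag (fun k => a k ^ 2)] at h1
  exact h1.trans (hW.sum_sq l)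

theorem sqrt_div_sq (hn : 1 ≤ n) (A x : ℝ) (hA : 0 ≤ A) : √(A * (x / n ^ 2)) = √A * (√x / n) := by
  rw [Real.sqrt_mul hA, Real.sqrt_div' _ (by positivity), Real.sqrt_sq (by positivity)]

/-- The inner sums are predictable, with `L^{2p}` norm `O(√c / n)` by the square-root bound; the
outer sum is then a martingale in `L^p`. -/
theorem lpBound_quad (M : MartingaleApprox F Pr p K G g) (hW : WeightBounds a n c A)
    (hA : 0 ≤ A) (hn : 1 ≤ n) :
    LpBound Pr p (fun ω => ∑ l ∈ Finset.Icc 1 n, ∑ j ∈ Finset.Icc 1 (l - 1),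
        a (l - j) * (G l ω - g (l - 1) ω) * (G j ω - g (j - 1) ω))
      (64 * √A * K ^ 2 * (√c / n * (n : ℝ) ^ (1 / p))) := by
  have hK := M.nonneg
  have hY : ∀ l, StronglyMeasurable[F (l - 1)] fun ω => ∑ j ∈ Finset.Icc 1 (l - 1),
      a (l - j) * (G j ω - g (j - 1) ω) := fun l =>
    (M.diff.const_mul fun j => a (l - j)).stronglyMeasurable_sum (l - 1)
  refine ((M.lpBound_predictable_sum (n := n) (L := 8 * K * √(A * (c / n ^ 2)))
    (by positivity) (hY 0) (fun j => hY (j + 1)) fun l _ =>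
    M.lpBound_sum_mul (fun j => a (l - j)) (l - 1) (sum_Icc_sq_le hW l)).mono
    (le_of_eq ?_)).congr fun ω => ?_
  · rw [sqrt_div_sq hn A c hA]
    ring
  · refine Finset.sum_congr rfl fun l _ => ?_
    rw [Finset.sum_mul]
    exact Finset.sum_congr rfl fun j _ => by ring

theorem lpBound_sum_diff (M : MartingaleApprox F Pr p K G g) (hW : WeightBounds a n c A)
    (l : ℕ) : LpBound Pr (2 * p)
      (fun ω => ∑ j ∈ Finset.Icc 1 l, (a (l - j) - a (l - j + 1)) * g (j - 1) ω) (A / n * K) := by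
  refine (LpBound.sum_const_mul M.one_le_two_mul fun j _ => M.bound_next (j - 1)).mono
    (mul_le_mul_of_nonneg_right ?_ M.nonneg)
  rw [sum_Icc_lag (fun k => |a k - a (k + 1)|)]
  exact hW.sum_diff l

theorem lpBound_sum_mul_sum (M : MartingaleApprox F Pr p K G g) {Y : ℕ → Ω → ℝ} {L : ℝ}
    (hb : ∀ l ∈ Finset.Icc 1 n, LpBound Pr (2 * p) (Y l) L) :
    LpBound Pr p (fun ω => ∑ l ∈ Finset.Icc 1 n, g (l - 1) ω * Y l ω) (n * (K * L)) := by
  refine (LpBound.sum M.one_lt.le fun l hl =>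
    (M.bound_next (l - 1)).mul M.one_lt.le (hb l hl)).mono (le_of_eq ?_)
  simp

/-- Termwise along `remZeta_eq`. The two martingale sums give `n ^ (1 / p) / n`, the first
differences `√(1 / c)`, the second differences `1 / c`, and the boundary terms `√c / n` and `1 / n`.
-/
theorem lpBound_remZeta (M : MartingaleApprox F Pr p K G g) (hW : WeightBounds a n c A)
    (hA : 0 ≤ A) (hn : 1 ≤ n) :
    LpBound Pr p (fun ω => remZeta a n (fun j => G j ω) fun j => g j ω)
      (K ^ 2 * (8 * (1 + A) * ((n : ℝ) ^ (1 / p) / n) + 8 * √A * (√(1 / c))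
        + A * (1 / c) + 16 * √A * (√c / n) + (3 * A + 2) * (1 / n))) := by
  have hK := M.nonneg
  have hp1 := M.one_lt.le
  have h2p := M.one_le_two_mul
  have hn0 : (0 : ℝ) < n := by positivity
  have hprev : ∀ j, StronglyMeasurable[F j] (g (j + 1 - 1)) := fun j => M.meas j
  have z1 := (M.lpBound_predictable_sum (n := n) (Y := fun l => g (l - 1)) hK (M.meas 0)
    hprev fun l _ => M.bound_next (l - 1)).const_mul (a 0)
  have z2 := M.lpBound_sum_mul_sum (n := n) fun l _ =>
    M.lpBound_sum_mul (fun j => firstDiff a (a 0) (l - j)) l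
      (by rw [sum_Icc_lag (fun k => firstDiff a (a 0) k ^ 2)]; exact hW.sum_firstDiff l)
  have hYm : ∀ l, StronglyMeasurable[F (l - 1)]
      fun ω => ∑ j ∈ Finset.Icc 1 l, (a (l - j) - a (l - j + 1)) * g (j - 1) ω := fun l =>
    Finset.stronglyMeasurable_fun_sum _ fun j hj => stronglyMeasurable_const.mul
      ((M.meas (j - 1)).mono (F.mono (Nat.sub_le_sub_right (Finset.mem_Icc.1 hj).2 1)))
  have z3 := M.lpBound_predictable_sum (n := n) (L := A / n * K) (by positivity)
    (hYm 0) (fun j => hYm (j + 1)) fun l _ => M.lpBound_sum_diff hW l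
  have z4 := M.lpBound_sum_mul_sum (n := n) (L := A * (1 / (n * c)) * K) fun l _ =>
    (LpBound.sum_const_mul (s := Finset.Icc 1 l) (a := fun j => secondDiff a (a 0) (l - j))
      h2p fun j _ => M.bound_next (j - 1)).mono (mul_le_mul_of_nonneg_right
      (by rw [sum_Icc_lag (fun k => |secondDiff a (a 0) k|)]; exact hW.sum_secondDiff l) hK)
  have hsq : ∑ l ∈ Finset.Icc 1 n, a l ^ 2 ≤ A * (c / n ^ 2) := by
    refine le_trans ?_ (hW.sum_sq (n + 1))
    refine Finset.sum_le_sum_of_subset_of_nonneg (fun l hl => ?_) fun _ _ _ => sq_nonneg _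
    simp only [Finset.mem_Icc, Finset.mem_range] at *
    omega
  have z5a := M.lpBound_sum_mul (fun l => a l) n hsq
  have z5b := (LpBound.sum_const_mul (s := Finset.Icc 1 n) (a := fun l => a l - a (l - 1))
      h2p fun l _ => M.bound_next (l - 1)).mono (L := A / n * K) (mul_le_mul_of_nonneg_right
      (by
        refine le_trans (le_of_eq ?_) (hW.sum_diff n)
        refine Finset.sum_nbij' (fun l => l - 1) (fun k => k + 1) ?_ ?_ ?_ ?_ ?_
        · intro l hl; simp only [Finset.mem_Icc, Finset.mem_range] at *; omega
        · intro l hl; simp only [Finset.mem_Icc, Finset.mem_range] at *; omega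
        · intro l hl; simp only [Finset.mem_Icc] at *; omega
        · intro l hl; simp
        · intro l hl
          rw [Nat.cast_sub (Finset.mem_Icc.1 hl).1, abs_sub_comm]
          simp) hK)
  have z5 := (M.bound_next 0).mul hp1 (z5a.add h2p z5b)
  have hsq' : ∑ j ∈ Finset.Icc 1 n, a (n - j) ^ 2 ≤ A * (c / n ^ 2) := by
    rw [sum_Icc_lag (fun k => a k ^ 2)]
    exact hW.sum_sq n
  have z6 := (M.bound_next n).mul hp1
    (((((M.lpBound_sum_mul (fun j => a (n - j)) n hsq').add h2p (M.lpBound_sum_diff hW n)).add h2p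
      (((M.bound_next 0).const_mul (a n)).mono
        (mul_le_mul_of_nonneg_right (hW.abs_le n) hK)))).sub h2p
      ((M.bound_next n).const_mul (a 0)))
  have z7 := ((M.bound_next n).mul hp1 (M.bound n)).const_mul (a 0)
  have z := ((((((z1.add hp1 z2).add hp1 z3).add hp1 z4).add hp1 z5).sub hp1 z6).sub hp1 z7)
  refine (z.mono (le_of_eq ?_)).congr fun ω => ?_
  · rw [hW.zero, abs_of_pos (by positivity), sqrt_div_sq hn A c hA,
      show A * (1 / (n ^ 2 * c)) = A * ((1 / c) / n ^ 2) by rw [div_div, mul_comm c],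
      sqrt_div_sq hn A _ hA]
    field_simp
    ring
  · exact remZeta_eq a n (fun j => G j ω) (fun j => g j ω) hW.neg_one hn

/-- The sum of the observations is the sum of the increments minus the telescoping `g m - g 0`;
hence `8 * K * √n` plus two boundary terms. -/
theorem lpBound_partialSum (M : MartingaleApprox F Pr p K G g) {m : ℕ} (hm : m ≤ n)
    (hn : 1 ≤ n) :
    LpBound Pr (2 * p) (fun ω => ∑ j ∈ Finset.Icc 1 m, (G j ω - g j ω)) (10 * K * √n) := by
  have hK := M.nonneg
  have h2p := M.one_le_two_mul
  refine ((((M.lpBound_sum_mul (fun _ => 1) m (s := m) (by simp)).add h2p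
    (M.bound_next 0)).sub h2p (M.bound_next m)).mono ?_).congr fun ω => ?_
  · have h1 : √(m : ℝ) ≤ √n := Real.sqrt_le_sqrt (by exact_mod_cast hm)
    have h2 : 1 ≤ √(n : ℝ) := Real.one_le_sqrt.2 (by exact_mod_cast hn)
    nlinarith [mul_le_mul_of_nonneg_left h1 hK, mul_le_mul_of_nonneg_left h2 hK]
  · have t := sum_Icc_telescope (fun j => g j ω) m
    have e : ∑ j ∈ Finset.Icc 1 m, (G j ω - g j ω)
        = ∑ j ∈ Finset.Icc 1 m, 1 * (G j ω - g (j - 1) ω)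
          - ∑ j ∈ Finset.Icc 1 m, (g j ω - g (j - 1) ω) := by
      rw [← Finset.sum_sub_distrib]
      exact Finset.sum_congr rfl fun j _ => by ring
    rw [e, t]
    ring

/-- Interchanging sums turns the weighted sums of observations into sums of `w (k / c)` times
partial sums, each of norm `O(√n)`. The total window mass is at most `b * c`, and the last term `O(1
/ n)` is absorbed through `c₀ ≤ c`. -/
theorem lpBound_remR (M : MartingaleApprox F Pr p K G g) {b : ℝ} {w : ℝ → ℝ} (hw : Window b w)
    {c₀ : ℝ} (hc₀ : 0 < c₀) (hc : c₀ ≤ c) (hn : 1 ≤ n) :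
    LpBound Pr p (fun ω => remR w c n fun j => G j ω - g j ω)
      (K ^ 2 * ((800 * b + 100 / c₀) * (c / n))) := by
  have hK := M.nonneg
  have hp1 := M.one_lt.le
  have h2p := M.one_le_two_mul
  have hcp : 0 < c := hc₀.trans_le hc
  have hn0 : (0 : ℝ) < n := by positivity
  have hb := hw.pos
  set s : ℕ → Ω → ℝ := fun m ω => ∑ j ∈ Finset.Icc 1 m, (G j ω - g j ω) with hs
  have hS : ∀ m ≤ n, LpBound Pr (2 * p) (s m) (10 * K * √n) := fun m hm =>
    M.lpBound_partialSum hm hn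
  have hw0 : ∀ k : ℕ, 0 ≤ w (k / c) := fun k => (hw.mem _ (by positivity)).1
  have hwsum : ∑ k ∈ Finset.Icc 1 (n - 1), |w (k / c)| ≤ b * c := by
    simp only [fun k : ℕ => abs_of_nonneg (hw0 k)]
    exact hw.sum_le hcp _
  have hSK : 0 ≤ 10 * K * √n := by positivity
  have r2 := (LpBound.sum_const_mul (s := Finset.Icc 1 (n - 1)) (a := fun k => w (k / c)) h2p
    fun k hk => (hS n le_rfl).sub h2p (hS k (by have := (Finset.mem_Icc.1 hk).2; omega))).mono
      (mul_le_mul_of_nonneg_right hwsum (by positivity))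
  have r3 := (LpBound.sum_const_mul (s := Finset.Icc 1 (n - 1)) (a := fun k => w (k / c)) h2p
    fun k hk => (hS (n - k) (Nat.sub_le n k))).mono
      (mul_le_mul_of_nonneg_right hwsum hSK)
  have hW : |∑ k ∈ Finset.Icc 1 (n - 1), w (k / c) * (1 - (k : ℝ) / n)| ≤ b * c := by
    refine (Finset.abs_sum_le_sum_abs _ _).trans (le_trans (Finset.sum_le_sum fun k hk => ?_) hwsum)
    rw [abs_mul]
    have h1 : (k : ℝ) / n ≤ 1 := by
      rw [div_le_one hn0]
      have := (Finset.mem_Icc.1 hk).2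
      exact_mod_cast (by omega : k ≤ n)
    have h2 : 0 ≤ (k : ℝ) / n := by positivity
    exact mul_le_of_le_one_right (abs_nonneg _) (abs_le.2 ⟨by linarith, by linarith⟩)
  have rss := (hS n le_rfl).mul hp1 (hS n le_rfl)
  have r1 := (rss.const_mul (∑ k ∈ Finset.Icc 1 (n - 1), w (k / c) * (1 - (k : ℝ) / n))).mono
    (mul_le_mul_of_nonneg_right hW (by positivity))
  have r := ((r1.const_mul (2 * ((n : ℝ) ^ 2)⁻¹)).sub hp1
    (((hS n le_rfl).mul hp1 (r2.add h2p r3)).const_mul (2 * ((n : ℝ) ^ 2)⁻¹))).sub hp1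
      (rss.const_mul (((n : ℝ) ^ 2)⁻¹))
  refine (r.mono ?_).congr fun ω => ?_
  · have hsq : √(n : ℝ) * √n = n := Real.mul_self_sqrt hn0.le
    have e1 : 10 * K * √(n : ℝ) * (10 * K * √n) = 100 * K ^ 2 * n := by
      linear_combination 100 * K ^ 2 * hsq
    have e2 : 10 * K * √(n : ℝ) * (b * c * (10 * K * √n + 10 * K * √n) + b * c * (10 * K * √n))
        = 300 * b * c * K ^ 2 * n := by
      linear_combination 300 * b * c * K ^ 2 * hsq
    rw [e1, e2, abs_of_pos (by positivity), abs_of_pos (by positivity)]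
    have h1 : 1 ≤ c / c₀ := (one_le_div hc₀).2 hc
    have e3 : 2 * ((n : ℝ) ^ 2)⁻¹ * (b * c * (100 * K ^ 2 * n))
        + 2 * ((n : ℝ) ^ 2)⁻¹ * (300 * b * c * K ^ 2 * n)
        + ((n : ℝ) ^ 2)⁻¹ * (100 * K ^ 2 * n)
        = K ^ 2 * (800 * b * (c / n)) + K ^ 2 * (100 / n) * 1 := by
      field_simp
      ring
    rw [e3]
    calc _ ≤ K ^ 2 * (800 * b * (c / n)) + K ^ 2 * (100 / n) * (c / c₀) := by gcongr
      _ = _ := by field_simp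
  · rw [remR, sum_mul_sum_upper (fun j => G j ω - g j ω) (fun k => w (k / c)) n,
      sum_mul_sum_lower (fun j => G j ω - g j ω) (fun k => w (k / c))]
    have e : ∀ k ∈ Finset.Icc 1 (n - 1),
        w (k / c) * ∑ j ∈ Finset.Icc 1 (n - k), (G (j + k) ω - g (j + k) ω)
          = w (k / c) * (s n ω - s k ω) := fun k hk => by
      rw [sum_Icc_shift (fun j => G j ω - g j ω)
        (by have := (Finset.mem_Icc.1 hk).2; omega : k ≤ n)]
    rw [Finset.sum_congr rfl e]
    simp only [hs]
    ring

end MartingaleApprox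

/-! ### Comparison of rates -/

theorem rpow_le_mul_rpow_of_le {x y e κ : ℝ} (hy : 0 < y) (hκ : 0 < κ)
    (hxy : y ≤ κ * x) (he : e ≤ 0) : x ^ e ≤ κ ^ (-e) * y ^ e := by
  have h1 : y / κ ≤ x := by rw [div_le_iff₀ hκ]; linarith
  refine (Real.rpow_le_rpow_of_nonpos (by positivity) h1 he).trans (le_of_eq ?_)
  rw [Real.div_rpow hy.le hκ.le, Real.rpow_neg hκ.le]
  ring

theorem rpow_le_rpow_mul_of_exponent_le {c c₀ s t : ℝ} (hc₀ : 0 < c₀) (hc : c₀ ≤ c)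
    (hst : s ≤ t) : c ^ s ≤ c₀ ^ (s - t) * c ^ t := by
  have hcp := hc₀.trans_le hc
  have e : c ^ s = c ^ (s - t) * c ^ t := by rw [← Real.rpow_add hcp]; congr 1; ring
  rw [e]
  gcongr ?_ * _
  exact Real.rpow_le_rpow_of_nonpos hc₀ hc (by linarith)

/-- All five rates are dominated by `c ^ (-1 + 1 / p)`: `c ≤ κ * n` converts powers of `n` into
powers of `c`, and `c₀ ≤ c` raises smaller exponents. The maximum is `1 / p` because `p ≤ 3 / 2`. -/
theorem exists_rate_bound {p c₀ κ A : ℝ} (hp : 1 < p) (hp2 : p ≤ 3 / 2) (hc₀ : 0 < c₀)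
    (hκ : 0 < κ) (hA : 0 ≤ A) : ∃ D : ℝ, 0 ≤ D ∧ ∀ n : ℕ, 1 ≤ n → ∀ c, c₀ ≤ c → c ≤ κ * n →
      8 * (1 + A) * ((n : ℝ) ^ (1 / p) / n) + 8 * √A * (√(1 / c))
        + A * (1 / c) + 16 * √A * (√c / n) + (3 * A + 2) * (1 / n)
      ≤ D * c ^ (-1 + max (1 / 2) (1 / p)) := by
  have hp0 : 0 < p := by linarith
  have hmax : max (1 / 2) (1 / p) = 1 / p :=
    max_eq_right (one_div_le_one_div_of_le hp0 (by linarith))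
  have hp1 : 1 / p < 1 := (div_lt_one hp0).2 hp
  have hph : 1 / 2 ≤ 1 / p := one_div_le_one_div_of_le hp0 (by linarith)
  set e := -1 + 1 / p with he
  refine ⟨8 * (1 + A) * κ ^ (-e) + 8 * √A * c₀ ^ (-(1 / 2) - e) + A * c₀ ^ (-1 - e)
    + 16 * √A * (κ * c₀ ^ (-(1 / 2) - e)) + (3 * A + 2) * (κ * c₀ ^ (-1 - e)), by positivity,
    fun n hn c hc hcn => ?_⟩
  have hcp := hc₀.trans_le hc
  have hn0 : (0 : ℝ) < n := by positivity
  rw [hmax]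
  have b1 : (n : ℝ) ^ (1 / p) / n ≤ κ ^ (-e) * c ^ e := by
    rw [← Real.rpow_sub_one hn0.ne', show 1 / p - 1 = e by rw [he]; ring]
    exact rpow_le_mul_rpow_of_le hcp hκ hcn (by rw [he]; linarith)
  have b2 : √(1 / c) ≤ c₀ ^ (-(1 / 2) - e) * c ^ e := by
    refine le_trans (le_of_eq ?_) (rpow_le_rpow_mul_of_exponent_le hc₀ hc
      (by rw [he]; linarith : -(1 / 2) ≤ e))
    rw [Real.sqrt_eq_rpow, one_div, Real.inv_rpow hcp.le, Real.rpow_neg hcp.le]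
  have b3 : 1 / c ≤ c₀ ^ (-1 - e) * c ^ e := by
    refine le_trans (le_of_eq ?_) (rpow_le_rpow_mul_of_exponent_le hc₀ hc
      (by rw [he]; linarith [one_div_pos.2 hp0] : -1 ≤ e))
    rw [Real.rpow_neg_one, one_div]
  have b5 : 1 / (n : ℝ) ≤ κ * (1 / c) := by
    rw [mul_one_div, div_le_div_iff₀ hn0 hcp]
    linarith
  have b4 : √c / n ≤ κ * √(1 / c) := by
    have h1 : √c * (1 / c) = √(1 / c) := by
      rw [one_div, Real.sqrt_inv, ← div_eq_mul_inv, Real.sqrt_div_self', one_div]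
    calc √c / n = √c * (1 / n) := by ring
      _ ≤ √c * (κ * (1 / c)) := by gcongr
      _ = κ * √(1 / c) := by rw [← h1]; ring
  have b4' := b4.trans (mul_le_mul_of_nonneg_left b2 hκ.le)
  have b5' := b5.trans (mul_le_mul_of_nonneg_left b3 hκ.le)
  calc _ ≤ 8 * (1 + A) * (κ ^ (-e) * c ^ e) + 8 * √A * (c₀ ^ (-(1 / 2) - e) * c ^ e)
        + A * (c₀ ^ (-1 - e) * c ^ e) + 16 * √A * (κ * (c₀ ^ (-(1 / 2) - e) * c ^ e))
        + (3 * A + 2) * (κ * (c₀ ^ (-1 - e) * c ^ e)) := by gcongr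
    _ = _ := by ring

theorem sqrt_div_mul_rpow_eq {p c : ℝ} (hp : 1 < p) (hp2 : p ≤ 3 / 2) (hc : 0 < c) {n : ℕ}
    (hn : 1 ≤ n) : √c / n * (n : ℝ) ^ (1 / p)
      = (c / n) ^ (1 / 2 : ℝ) * (n : ℝ) ^ (-1 / 2 + max (1 / p) (1 / 2)) := by
  have hn0 : (0 : ℝ) < n := by positivity
  rw [max_eq_left (one_div_le_one_div_of_le (by linarith) (by linarith)),
    Real.div_rpow hc.le hn0.le, Real.sqrt_eq_rpow, Real.rpow_add hn0]
  have h : (n : ℝ) ^ (-1 / 2 : ℝ) * n = n ^ (1 / 2 : ℝ) := by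
    nth_rw 2 [← Real.rpow_one (n : ℝ)]
    rw [← Real.rpow_add hn0]
    norm_num
  rw [← h]
  have h0 : (n : ℝ) ^ (-1 / 2 : ℝ) ≠ 0 := (Real.rpow_pos_of_pos hn0 _).ne'
  field_simp

end Bounds

/-! ### The chain -/

section Chain

theorem abs_le_wFunNorm_mul {S : Type*} {V f : S → ℝ} (hV : ∀ x, 0 < V x)
    (hf : wFunNorm V f < ∞) (x : S) : |f x| ≤ (wFunNorm V f).toReal * V x := by
  rw [← div_le_iff₀ (hV x)]
  exact (ENNReal.ofReal_le_iff_le_toReal hf.ne).1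
    (le_iSup (fun x => ENNReal.ofReal (|f x| / V x)) x)

variable {Ω : Type*} [mΩ : MeasurableSpace Ω] {Pr : Measure Ω}

theorem LpBound.of_abs_le {f v : Ω → ℝ} {r K B : ℝ} (hv : LpBound Pr r v K) (hB : 0 ≤ B)
    (hf : AEStronglyMeasurable f Pr) (hfv : ∀ ω, |f ω| ≤ B * v ω) : LpBound Pr r f (B * K) := by
  have h := hv.const_mul B
  rw [abs_of_nonneg hB] at h
  exact ⟨hf, h.nonneg, (eLpNorm_mono_real hfv).trans h.le⟩

theorem LpBound.eLpNorm_le {f : Ω → ℝ} {p H E D D' T : ℝ} {N : ℝ≥0∞}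
    (hf : LpBound Pr p f ((H * E) ^ 2 * (D * T))) (hD : D ≤ D') (hD0 : 0 ≤ D') (hT : 0 ≤ T)
    (hN : ENNReal.ofReal H = N) (hH : 0 ≤ H) :
    eLpNorm f (ENNReal.ofReal p) Pr ≤ ((E ^ 2 * D').toNNReal : ℝ≥0) * N ^ 2 * ENNReal.ofReal T := by
  have h : (H * E) ^ 2 * (D * T) ≤ E ^ 2 * D' * H ^ 2 * T := by
    have := mul_le_mul_of_nonneg_left (mul_le_mul_of_nonneg_right hD hT) (sq_nonneg (H * E))
    calc _ ≤ (H * E) ^ 2 * (D' * T) := this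
      _ = _ := by ring
  refine (hf.mono h).le.trans (le_of_eq ?_)
  rw [ENNReal.ofReal_mul (by positivity), ENNReal.ofReal_mul (by positivity),
    ENNReal.ofReal_pow hH, hN]
  rfl

variable {S : Type*} [MeasurableSpace S] {P : Kernel S S}
  [IsMarkovKernel P] {μ : Measure S} [IsProbabilityMeasure μ] {X : ℕ → Ω → S}
  {V₁ V₂ V₃ : S → ℝ}

theorem Ergodicity.one_le₂ (hA : Ergodicity P μ Pr X V₁ V₂ V₃) (x : S) : 1 ≤ V₂ x :=
  (hA.one_le x).trans (hA.le₁₂ x)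

theorem Ergodicity.le₃ (hA : Ergodicity P μ Pr X V₁ V₂ V₃) (x : S) : V₂ x ≤ V₃ x := by
  have := hA.one_le₂ x
  have := hA.le₂₃ x
  nlinarith

theorem Ergodicity.exists_moment (hA : Ergodicity P μ Pr X V₁ V₂ V₃)
    (hX : ∀ n, Measurable (X n)) : ∃ p : ℝ, 1 < p ∧ p ≤ 3 / 2 ∧ ∃ M : ℝ, 0 ≤ M ∧
      ∀ n, LpBound Pr (2 * p) (fun ω => V₂ (X n ω)) M := by
  obtain ⟨q, hq, hfin⟩ := hA.moment
  -- The bound by `q` gives `V₂ ^ (2 * p) ≤ V₃ ^ p ≤ V₃ ^ q`, using `V₃ ≥ 1`; the bound by `3 / 2`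
  -- makes `2 * p ≤ 3`, as the square-root inequality requires.
  set p := min q (3 / 2) with hp
  have hp1 : 1 < p := lt_min hq (by norm_num)
  set m := ⨆ n : ℕ, ∫⁻ ω, ENNReal.ofReal (V₃ (X n ω) ^ q) ∂Pr with hm
  refine ⟨p, hp1, min_le_right _ _, (m ^ (1 / (2 * p))).toReal, ENNReal.toReal_nonneg,
    fun n => ⟨(hA.measurable₂.comp (hX n)).aestronglyMeasurable, ENNReal.toReal_nonneg, ?_⟩⟩
  rw [ENNReal.ofReal_toReal (ENNReal.rpow_ne_top_of_nonneg (by positivity) hfin.ne),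
    eLpNorm_eq_lintegral_rpow_enorm_toReal (by simp; linarith) ENNReal.ofReal_ne_top,
    ENNReal.toReal_ofReal (by positivity)]
  refine ENNReal.rpow_le_rpow (le_trans (lintegral_mono fun ω => ?_)
    (le_iSup (fun n => ∫⁻ ω, ENNReal.ofReal (V₃ (X n ω) ^ q) ∂Pr) n)) (by positivity)
  have h2 := hA.one_le₂ (X n ω)
  have h3 := hA.le₂₃ (X n ω)
  simp only [Real.enorm_eq_ofReal_abs]
  rw [abs_of_nonneg (by linarith), ENNReal.ofReal_rpow_of_nonneg (by linarith) (by linarith)]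
  refine ENNReal.ofReal_le_ofReal ?_
  rw [Real.rpow_mul (by linarith), Real.rpow_two]
  calc (V₂ (X n ω) ^ 2) ^ p ≤ V₃ (X n ω) ^ p := by gcongr
    _ ≤ V₃ (X n ω) ^ q := Real.rpow_le_rpow_of_exponent_le
      (h2.trans (hA.le₃ _)) (min_le_left _ _)

/-- Properties of the solution of the Poisson equation, with a constant uniform in `h`. -/
theorem Ergodicity.exists_poisson (hA : Ergodicity P μ Pr X V₁ V₂ V₃) :
    ∃ C : ℝ, 0 ≤ C ∧ ∀ h : S → ℝ, MemLW V₁ h → ∫ x, h x ∂μ = 0 →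
      (∀ x, Summable fun j : ℕ => ∫ z, h z ∂((P ^ j) x)) ∧
      (∀ x, Integrable (poissonSol P h) (P x)) ∧
      (∀ x, h x = poissonSol P h x - poissonSolNext P h x) ∧
      (∀ x, |poissonSol P h x| ≤ (wFunNorm V₁ h).toReal * C * V₂ x) ∧
      ∀ x, |poissonSolNext P h x| ≤ (wFunNorm V₁ h).toReal * C * V₂ x := by
  have hV₁ : ∀ x, 0 < V₁ x := fun x => one_pos.trans_le (hA.one_le x)
  have hV₂ : ∀ x, 0 ≤ V₂ x := fun x => zero_le_one.trans (hA.one_le₂ x)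
  obtain ⟨C, hC0, hC⟩ := hA.shortRange₁₂.exists_bound hA.measurable₁ (fun x => (hV₁ x).le) hV₂
  refine ⟨C, hC0, fun h hh hμ => ?_⟩
  set H := (wFunNorm V₁ h).toReal with hH
  have hx := hC h H hh.1 ENNReal.toReal_nonneg (abs_le_wFunNorm_mul hV₁ hh.2) hμ
  have hHC : 0 ≤ H * C := mul_nonneg ENNReal.toReal_nonneg hC0
  have hsum := fun x => (hx x).2.1
  have hG : ∀ x, |poissonSol P h x| ≤ H * C * V₂ x := fun x =>
    (abs_tsum_le_of_summable (hsum x)).trans (hx x).2.2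
  have hfin : ∀ x, ∫⁻ z, ENNReal.ofReal (H * C * V₂ z) ∂(P x) < ∞ := fun x => by
    refine (lintegral_mono (g := fun z => ENNReal.ofReal (H * C) * ENNReal.ofReal (V₃ z))
      fun z => ?_).trans_lt ?_
    · simp only
      rw [← ENNReal.ofReal_mul hHC]
      exact ENNReal.ofReal_le_ofReal (mul_le_mul_of_nonneg_left (hA.le₃ z) hHC)
    · rw [lintegral_const_mul _ hA.measurable₃.ennreal_ofReal]
      exact ENNReal.mul_lt_top ENNReal.ofReal_lt_top (hA.finite x)
  have hpoi := fun x => poissonSol_eq_add hh.1 hsum (fun x => (hx x).2.2) (fun x => (hx x).1) x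
    (hfin x)
  refine ⟨fun x => (hsum x).of_abs, fun x => ?_, fun x => ?_, hG, fun x => ?_⟩
  · exact integrable_of_abs_le (H := 1) (measurable_poissonSol P hh.1)
      (fun z => mul_nonneg hHC (hV₂ z)) (fun z => by rw [one_mul]; exact hG z) (hfin x)
      (hA.measurable₂.const_mul _)
  · rw [(hpoi x).2]
    ring
  · rw [(hpoi x).1]
    -- `PG` is the tail of the series for `G`, so it inherits the same bound by `V₂(x)`; no estimate
    -- of `PV₂` by `V₂` is needed.
    have hs1 : Summable fun j => |∫ z, h z ∂((P ^ (j + 1)) x)| :=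
      (summable_nat_add_iff 1).2 (hsum x)
    refine (abs_tsum_le_of_summable hs1).trans (le_trans ?_ (hx x).2.2)
    rw [(hsum x).tsum_eq_zero_add]
    exact le_add_of_nonneg_left (abs_nonneg _)

theorem martingale_quadMart [IsFiniteMeasure Pr] {P : Kernel S S} {F : Filtration ℕ mΩ} {p K : ℝ} {h : S → ℝ} (a : ℤ → ℝ)
    (M : MartingaleApprox F Pr p K (fun j ω => poissonSol P h (X j ω))
      fun j ω => poissonSolNext P h (X j ω)) :
    Martingale (quadMart a P h X) F Pr := by
  have hY : ∀ l, StronglyMeasurable[F (l - 1)] fun ω => ∑ j ∈ Finset.Icc 1 (l - 1),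
      a (l - j) * incr P h X j ω := fun l =>
    (M.diff.const_mul fun j => a (l - j)).stronglyMeasurable_sum (l - 1)
  have hd := M.diff.predictable_mul (Y := fun (l : ℕ) ω => ∑ j ∈ Finset.Icc 1 (l - 1),
    a (l - j) * incr P h X j ω) (hY 0) fun j => hY (j + 1)
  have he : quadMart a P h X = fun (m : ℕ) ω => ∑ l ∈ Finset.Icc 1 m,
      (∑ j ∈ Finset.Icc 1 (l - 1), a (l - j) * incr P h X j ω) *
        (poissonSol P h (X l ω) - poissonSolNext P h (X (l - 1) ω)) := by
    ext m ω
    refine Finset.sum_congr rfl fun l _ => ?_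
    rw [Finset.sum_mul]
    exact Finset.sum_congr rfl fun j _ => by simp only [incr]; ring
  rw [he]
  refine hd.martingale_sum fun l _ => ?_
  refine MemLp.integrable (q := ENNReal.ofReal p) (by simpa using M.one_lt.le) ?_
  exact ((M.lpBound_sum_mul (fun j => a (l - j)) (l - 1) le_rfl).mul M.one_lt.le
    (M.lpBound_incr l)).memLp

end Chain

end LagWindow

end

/-! ### Assembly of the decomposition and the three moment bounds. -/

theorem theorem1
    {S Ω : Type*} [MeasurableSpace S] [MeasurableSpace.CountablyGenerated S] [MeasurableSpace Ω]
    (Pr : Measure Ω) [IsProbabilityMeasure Pr]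
    (P : Kernel S S) [IsMarkovKernel P]
    (μ : Measure S) [IsProbabilityMeasure μ] (hμ : Kernel.Invariant P μ)
    (X : ℕ → Ω → S) (hX : LagWindow.IsMarkovChain P Pr X)
    (V₁ V₂ V₃ : S → ℝ) (hA : LagWindow.Ergodicity P μ Pr X V₁ V₂ V₃)
    (b : ℝ) (w : ℝ → ℝ) (hw : LagWindow.Window b w)
    (c : ℕ → ℝ) (hc : LagWindow.Bandwidth c) :
    (∀ h : S → ℝ, LagWindow.MemLW V₁ h → ∫ x, h x ∂μ = 0 →
      (∀ x, Summable fun j : ℕ => ∫ z, h z ∂((P ^ j) x)) ∧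
      (∀ x, Integrable (LagWindow.poissonSol P h) (P x)) ∧
      ∀ n : ℕ, 1 ≤ n →
        (∀ ω, LagWindow.gammaSq w c h X n ω
          = (n : ℝ)⁻¹ * ∑ ℓ ∈ Finset.Icc 1 n, LagWindow.incr P h X ℓ ω ^ 2
            + LagWindow.quadMart (LagWindow.weight w (c n) n) P h X n ω
            + LagWindow.chainR w c h X n ω
            + LagWindow.chainZeta w c P h X n ω) ∧
        Martingale (LagWindow.quadMart (LagWindow.weight w (c n) n) P h X)
          (LagWindow.history X hX.measurable) Pr) ∧
    ∃ p : ℝ, 1 < p ∧ ∃ C : ℝ≥0,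
      ∀ h : S → ℝ, LagWindow.MemLW V₁ h → ∫ x, h x ∂μ = 0 → ∀ n : ℕ, 3 ≤ n →
        eLpNorm (LagWindow.chainZeta w c P h X n) (ENNReal.ofReal p) Pr
          ≤ C * LagWindow.wFunNorm V₁ h ^ 2
            * ENNReal.ofReal (c n ^ (-1 + max (1 / 2) (1 / p))) ∧
        eLpNorm (LagWindow.chainR w c h X n) (ENNReal.ofReal p) Pr
          ≤ C * LagWindow.wFunNorm V₁ h ^ 2 * ENNReal.ofReal (c n / n) ∧
        eLpNorm (LagWindow.quadMart (LagWindow.weight w (c n) n) P h X n)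
            (ENNReal.ofReal p) Pr
          ≤ C * LagWindow.wFunNorm V₁ h ^ 2
            * ENNReal.ofReal ((c n / n) ^ (1 / 2 : ℝ)
              * (n : ℝ) ^ (-1 / 2 + max (1 / p) (1 / 2))) := by
  obtain ⟨p, hp1, hp2, m, hm0, hm⟩ := hA.exists_moment hX.measurable
  obtain ⟨C, hC0, hC⟩ := hA.exists_poisson
  have happrox : ∀ h : S → ℝ, LagWindow.MemLW V₁ h → ∫ x, h x ∂μ = 0 →
      LagWindow.MartingaleApprox (LagWindow.history X hX.measurable) Pr p
        ((LagWindow.wFunNorm V₁ h).toReal * (C * m))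
        (fun j ω => LagWindow.poissonSol P h (X j ω))
        fun j ω => LagWindow.poissonSolNext P h (X j ω) := by
    intro h hh hμh
    obtain ⟨-, -, -, hG, hg⟩ := hC h hh hμh
    have hHC : 0 ≤ (LagWindow.wFunNorm V₁ h).toReal * C := mul_nonneg ENNReal.toReal_nonneg hC0
    have hGm := LagWindow.measurable_poissonSol P hh.1
    have hgm := LagWindow.measurable_poissonSolNext P hh.1
    have hGb : ∀ j, LagWindow.LpBound Pr (2 * p) (fun ω => LagWindow.poissonSol P h (X j ω))
        ((LagWindow.wFunNorm V₁ h).toReal * (C * m)) := fun j => by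
      rw [← mul_assoc]
      exact (hm j).of_abs_le hHC (hGm.comp (hX.measurable j)).aestronglyMeasurable
        fun ω => hG _
    refine ⟨hp1, hp2, hX.isMartingaleDifference_incr hh.1 fun n => ?_, fun l => ?_, hGb,
      fun j => ?_⟩
    · exact (hGb n).memLp.integrable (by rw [ENNReal.one_le_ofReal]; linarith)
    · exact (hgm.comp (LagWindow.measurable_history hX.measurable le_rfl)).stronglyMeasurable
    · rw [← mul_assoc]
      exact (hm j).of_abs_le hHC (hgm.comp (hX.measurable j)).aestronglyMeasurable
        fun ω => hg _
  refine ⟨fun h hh hμh => ?_, p, hp1, ?_⟩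
  · obtain ⟨h1, h2, h3, -, -⟩ := hC h hh hμh
    refine ⟨h1, h2, fun n hn => ⟨fun ω => ?_, LagWindow.martingale_quadMart _ (happrox h hh hμh)⟩⟩
    simp only [LagWindow.gammaSq, LagWindow.chainR, h3]
    exact LagWindow.estimator_decomposition w (c n) hn _ _
  · obtain ⟨κ₀, hκ₀⟩ := hc.le
    -- The maximum with `1` makes the constant positive, since powers of `κ` with a real exponent
    -- appear in the rate comparison.
    set κ := max κ₀ 1 with hκ
    have hκ1 : 0 < κ := lt_max_of_lt_right one_pos
    have hc₀ := hc.pos 1 le_rfl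
    have hcn : ∀ n, 1 ≤ n → c 1 ≤ c n := fun n hn => hc.mono (Set.mem_Ici.2 le_rfl) hn hn
    have hb := hw.pos
    obtain ⟨A, hA0, hW⟩ := hw.exists_weightBounds hc₀
    obtain ⟨D, hD0, hD⟩ := LagWindow.exists_rate_bound hp1 hp2 hc₀ hκ1 hA0
    -- One constant for all three bounds: `(C * m) ^ 2` comes from the quadratic dependence on the
    -- moment bound, and the summands serve `ζ_n`, `R_n` and the martingale. Monotonicity of the
    -- bandwidths makes `c 1` a uniform lower bound.
    refine ⟨((C * m) ^ 2 * (D + (800 * b + 100 / c 1) + 64 * √A)).toNNReal,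
      fun h hh hμh n hn => ?_⟩
    have hn1 : 1 ≤ n := by omega
    have M := happrox h hh hμh
    have hN := ENNReal.ofReal_toReal hh.2.ne
    have hcpos := hc.pos n hn1
    have hR : 0 ≤ 800 * b + 100 / c 1 := by positivity
    have hQ : 0 ≤ 64 * √A := by positivity
    have hD' : 0 ≤ D + (800 * b + 100 / c 1) + 64 * √A := by positivity
    refine ⟨?_, ?_, ?_⟩
    · have hcκ : c n ≤ κ * n := (hκ₀ n hn1).trans (by gcongr; exact le_max_left _ _)
      exact ((M.lpBound_remZeta (hW n hn1 (c n) (hcn n hn1)) hA0 hn1).mono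
        (mul_le_mul_of_nonneg_left (hD n hn1 (c n) (hcn n hn1) hcκ) (sq_nonneg _))).eLpNorm_le
        (by linarith) hD' (by positivity) hN ENNReal.toReal_nonneg
    · obtain ⟨-, -, h3, -, -⟩ := hC h hh hμh
      exact ((M.lpBound_remR hw hc₀ (hcn n hn1) hn1).congr fun ω => by
        simp only [LagWindow.chainR, h3]).eLpNorm_le
        (by linarith) hD' (by positivity) hN ENNReal.toReal_nonneg
    · have hq := M.lpBound_quad (hW n hn1 (c n) (hcn n hn1)) hA0 hn1
      rw [LagWindow.sqrt_div_mul_rpow_eq hp1 hp2 hcpos hn1, mul_comm (64 * √A), mul_assoc] at hq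
      exact hq.eLpNorm_le (by linarith) hD' (by positivity) hN ENNReal.toReal_nonneg
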